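/- **Setting.** Let $(A,\mathfrak m)$ be a complete regular local ring of mixed characteristic $(0,p)$ and dimension $d$. Let $K^\circ=\widehat{\mathbb Z_p[p^{1/p^\infty}]}$ ($p$-adic completion). A $K^\circ$-algebra $S$ is *integral perfectoid* if it is $p$-adically complete, $p$-torsion free, integrally closed in $S[1/p]$, and the Frobenius induces an isomorphism $S/p^{1/p}\to S/p$. "Almost zero" means annihilated by $p^{1/p^k}$ for every $k\ge 1$; for an element $z$ this is written $p^{1/p^\infty}z=0$. Fix an $A$-algebra $A_\infty$ that is an integral perfectoid $K^\circ$-algebra such that - every element of $A$ has a compatible system of $p$-power roots in $A_\infty$; - $A\to A_\infty$ is almost flat: $\operatorname{Tor}^A_i(M,A_\infty)$ is almost zero for all $A$-modules $M$ and all $i>0$; - if $M$ is an $A$-module and $M\otimes_A A_\infty$ is almost zero, then $M=0$. **Definitions.** Let $\underline f=(f_1,\dots,f_n)$ and $\underline g=(g_1,\dots,g_m)$ be finite families of elements of $A$. For each $f_i$ and $g_j$ fix a compatible system of $p$-power roots $\{f_i^{1/p^e}\}_e$, $\{g_j^{1/p^e}\}_e$ in $A_\infty$, and write $[\underline f]$,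 $[\underline g]$ for these data. For real $t,s\ge 0$ let $0^{[\underline f]^t}$ be the set of $\eta\in H^d_{\mathfrak m}(A)$ such that for all $e>0$, $p^{1/p^\infty}x\,\eta=0$ in $H^d_{\mathfrak m}(A_\infty)$ for all products $x=\prod_{i=1}^{a} f_{j_i}^{1/p^e}$ with $a\ge tp^e$ factors (repetitions allowed). Let $0^{[\underline f]^t[\underline g]^s}$ be the set of $\eta\in H^d_{\mathfrak m}(A)$ such that for all $e>0$, $p^{1/p^\infty}xy\,\eta=0$ in $H^d_{\mathfrak m}(A_\infty)$ for all products $x=\prod_{i=1}^{a} f_{j_i}^{1/p^e}$ and $y=\prod_{i=1}^{b} g_{k_i}^{1/p^e}$ with $a\ge tp^e$ and $b\ge sp^e$. Put $$\tau^\sharp([\underline f]^t)=\operatorname{Ann}_A 0^{[\underline f]^t},\qquad \tau^\sharp([\underline f]^t[\underline g]^s)=\operatorname{Ann}_A 0^{[\underline f]^t[\underline g]^s},$$ $$\tau([\underline f]^t)=\sum_{\varepsilon>0}\tau^\sharp([\underline f]^{t+\varepsilon}),\qquad \tau([\underline f]^t[\underline g]^s)=\sum_{\varepsilon>0}\tau^\sharp([\underline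 f]^{t+\varepsilon}[\underline g]^{s+\varepsilon});$$ since these ideals grow as $\varepsilon$ decreases and $A$ is Noetherian, the sums equal the terms for all sufficiently small $\varepsilon>0$. For an integer $N\ge 1$ let $\underline f^{\bullet N}$ be the family of degree $N$ monomials in the $f_i$, with the products of the chosen roots of the $f_i$ as compatible systems of roots. **Theorem (Subadditivity).** For all real $t,s\ge 0$, $$\tau^\sharp([\underline f]^t[\underline g]^s)\subseteq\tau^\sharp([\underline f]^t)\cdot\tau^\sharp([\underline g]^s)\quad\text{and}\quad \tau([\underline f]^t[\underline g]^s)\subseteq\tau([\underline f]^t)\cdot\tau([\underline g]^s).$$ In particular, for all real $t\ge 0$, $\tau([\underline f]^{tN})\subseteq\tau([\underline f]^t)^N$ for all integers $N\ge 0$, and $\tau([\underline f^{\bullet N}]^t)=\tau([\underline f]^{tN})$ for all integers $N\ge 1$. -/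

import Mathlib

universe u

open CategoryTheory

noncomputable section

namespace PerfectoidTest

/-! ### The perfectoid base ring -/

/-- The relations `x₀ = p` and `xₖ₊₁ ^ p = xₖ`. -/
def rootRelations (p : ℕ) [Fact p.Prime] : Ideal (MvPolynomial ℕ ℤ_[p]) :=
  Ideal.span ({MvPolynomial.X 0 - MvPolynomial.C (p : ℤ_[p])} ∪
    Set.range fun k : ℕ => MvPolynomial.X (k + 1) ^ p - MvPolynomial.X k)

/-- The ring `ℤ_p[p^{1/p^∞}]`, by generators `p^{1/p^k}` and relations. -/
abbrev ZpRoots (p : ℕ) [Fact p.Prime] : Type :=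
  MvPolynomial ℕ ℤ_[p] ⧸ rootRelations p

/-- The ring of integers `K° = ℤ_p[p^{1/p^∞}]^` of the perfectoid field
`K = ℚ_p(p^{1/p^∞})^`; the completion is `p`-adic. -/
abbrev Kcirc (p : ℕ) [Fact p.Prime] : Type :=
  AdicCompletion (Ideal.span {(p : ZpRoots p)}) (ZpRoots p)

/-- The element `p^{1/p^k}` of `K°`. -/
def pRoot (p : ℕ) [Fact p.Prime] (k : ℕ) : Kcirc p :=
  algebraMap (ZpRoots p) (Kcirc p) (Ideal.Quotient.mk (rootRelations p) (MvPolynomial.X k))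

theorem pRoot_zero (p : ℕ) [Fact p.Prime] : pRoot p 0 = (p : Kcirc p) := by
  have h : Ideal.Quotient.mk (rootRelations p) (MvPolynomial.X 0) =
      Ideal.Quotient.mk (rootRelations p) (MvPolynomial.C (p : ℤ_[p])) :=
    Ideal.Quotient.eq.mpr (Ideal.subset_span (Or.inl rfl))
  unfold pRoot
  rw [h]
  simp

theorem pRoot_succ_pow (p : ℕ) [Fact p.Prime] (k : ℕ) : pRoot p (k + 1) ^ p = pRoot p k := by
  have h : Ideal.Quotient.mk (rootRelations p) (MvPolynomial.X (k + 1) ^ p) =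
      Ideal.Quotient.mk (rootRelations p) (MvPolynomial.X k) :=
    Ideal.Quotient.eq.mpr (Ideal.subset_span (Or.inr ⟨k, rfl⟩))
  unfold pRoot
  rw [← map_pow, ← map_pow, h]

/-- The image of `p^{1/p^k}` in a `K°`-algebra. -/
def pRootIn (p : ℕ) [Fact p.Prime] (S : Type u) [CommRing S] [Algebra (Kcirc p) S] (k : ℕ) : S :=
  algebraMap (Kcirc p) S (pRoot p k)

/-- Integral perfectoid `K°`-algebras `S`, with the convention that `S` is integrally closed in
`S[1/p]`. -/
structure IsIntegralPerfectoid (p : ℕ) [Fact p.Prime] (S : Type u) [CommRing S]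
    [Algebra (Kcirc p) S] : Prop where
  complete : IsAdicComplete (Ideal.span {(p : S)}) S
  torsionFree : (p : S) ∈ nonZeroDivisors S
  /-- the `p`-th power map `S / p^{1/p} → S / p` is well defined and injective -/
  frobenius_injective : ∀ x y : S,
    x ^ p - y ^ p ∈ Ideal.span {(p : S)} ↔ x - y ∈ Ideal.span {pRootIn p S 1}
  /-- the `p`-th power map `S / p^{1/p} → S / p` is surjective -/
  frobenius_surjective : ∀ y : S, ∃ x : S, x ^ p - y ∈ Ideal.span {(p : S)}
  integrallyClosed : IsIntegrallyClosedIn S (Localization.Away (p : S))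

/-! ### Compatible systems of roots, almost flatness and the algebra `A_∞` -/

/-- A compatible system `{x^{1/p^e}}_e` of `p`-power roots of `x` in `S`. -/
@[ext]
structure RootSystem (p : ℕ) {S : Type u} [CommRing S] (x : S) where
  /-- the chosen element `x^{1/p^e}` -/
  root : ℕ → S
  root_zero : root 0 = x
  root_succ_pow : ∀ e, root (e + 1) ^ p = root e

section Almost

variable (p : ℕ) [Fact p.Prime] (A S : Type u) [CommRing A] [CommRing S] [Algebra (Kcirc p) S]
  [Algebra A S]

/-- `A → S` is almost flat: for all `A`-modules `M`, all `Tor_i^A(M, S)` with `i > 0` are almost zero, i.e. killed by every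
`p^{1/p^k}`, which acts on `Tor_i^A(M, S)` through its action on `S`. -/
def IsAlmostFlat : Prop :=
  ∀ (M : ModuleCat.{u} A) (i : ℕ), 0 < i → ∀ k : ℕ, 0 < k →
    ((Tor (ModuleCat.{u} A) i).obj M).map
      (ModuleCat.ofHom (LinearMap.mulLeft A (pRootIn p S k))) = 0

/-- If `S ⊗_A M` is almost zero, then `M = 0`. -/
def IsAlmostFaithful : Prop :=
  ∀ (M : Type u) [AddCommGroup M] [Module A M],
    (∀ k : ℕ, 0 < k → ∀ z : TensorProduct A S M, pRootIn p S k • z = 0) → Subsingleton M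

/-- The algebras `A_∞` that may be used to define perfectoid test ideals of `A`. -/
structure IsAinfty : Prop where
  perfectoid : IsIntegralPerfectoid p S
  exists_roots : ∀ x : A, Nonempty (RootSystem p (algebraMap A S x))
  almostFlat : IsAlmostFlat p A S
  almostFaithful : IsAlmostFaithful p A S

end Almost

/-! ### Perfectoid test ideals -/

section TestIdeals

variable (p : ℕ) [Fact p.Prime] (A : Type u) [CommRing A] [IsLocalRing A] (S : Type u)
  [CommRing S] [Algebra (Kcirc p) S] [Algebra A S] (d : ℕ)

/-- `H^d_𝔪(N)` for an `A`-module `N`, where `𝔪` is the maximal ideal of `A`. -/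
abbrev H (N : Type u) [AddCommGroup N] [Module A N] : ModuleCat.{u} A :=
  (localCohomology (IsLocalRing.maximalIdeal A) d).obj (ModuleCat.of A N)

/-- The map `H^d_𝔪(A) → H^d_𝔪(S)` induced by `A → S`. -/
def Hmap : H A d A →ₗ[A] H A d S :=
  ((localCohomology (IsLocalRing.maximalIdeal A) d).map
    (ModuleCat.ofHom (Algebra.linearMap A S))).hom

/-- Multiplication by `z ∈ S` on `H^d_𝔪(S)`. -/
def Hmul (z : S) : H A d S →ₗ[A] H A d S :=
  ((localCohomology (IsLocalRing.maximalIdeal A) d).map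
    (ModuleCat.ofHom (LinearMap.mulLeft A z))).hom

/-- The `η ∈ H^d_𝔪(A)` with `p^{1/p^∞} g η = 0` in `H^d_𝔪(S)` for all `g ∈ Λ`. -/
def zeroStar (Λ : Set S) : Submodule A (H A d A) where
  carrier := {η | ∀ g ∈ Λ, ∀ k : ℕ, 0 < k → Hmul A S d (pRootIn p S k * g) (Hmap A S d η) = 0}
  add_mem' ha hb g hg k hk := by rw [map_add, map_add, ha g hg k hk, hb g hg k hk, add_zero]
  zero_mem' g _ k _ := by rw [map_zero, map_zero]
  smul_mem' c _ hx g hg k hk := by rw [map_smul, map_smul, hx g hg k hk, smul_zero]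

variable {p A S} {ι κ : Type*} {f : ι → A} {g : κ → A}

/-- The products `∏_{i=1}^a f_{j_i}^{1/p^e}` of chosen roots with `a ≥ t p^e` factors. -/
def rootProducts (F : ∀ i, RootSystem p (algebraMap A S (f i))) (t : ℝ) (e : ℕ) : Set S :=
  {x | ∃ a : ℕ, t * (p : ℝ) ^ e ≤ a ∧ ∃ j : Fin a → ι, x = ∏ i, (F (j i)).root e}

/-- `τ♯([f]^t)`. The root systems `F` are the data denoted `[f]`. -/
def tauSharp (F : ∀ i, RootSystem p (algebraMap A S (f i))) (t : ℝ) : Ideal A :=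
  (zeroStar p A S d {x | ∃ e : ℕ, 0 < e ∧ x ∈ rootProducts F t e}).annihilator

/-- `τ♯([f]^t [g]^s)`. -/
def tauSharpMixed (F : ∀ i, RootSystem p (algebraMap A S (f i)))
    (G : ∀ i, RootSystem p (algebraMap A S (g i))) (t s : ℝ) : Ideal A :=
  (zeroStar p A S d {x | ∃ e : ℕ, 0 < e ∧
    ∃ y ∈ rootProducts F t e, ∃ z ∈ rootProducts G s e, x = y * z}).annihilator

/-- `τ([f]^t)`, the sum of all `τ♯([f]^{t+ε})` with `ε > 0`; if `A` is Noetherian this is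
`τ♯([f]^{t+ε})` for all small `ε > 0`, because these ideals grow as `ε` decreases. -/
def tau (F : ∀ i, RootSystem p (algebraMap A S (f i))) (t : ℝ) : Ideal A :=
  ⨆ (ε : ℝ) (_ : 0 < ε), tauSharp d F (t + ε)

/-- `τ([f]^t [g]^s)`, the sum of all `τ♯([f]^{t+ε} [g]^{s+ε})` with `ε > 0`; if `A` is Noetherian
this is `τ♯([f]^{t+ε} [g]^{s+ε})` for all small `ε > 0`. -/
def tauMixed (F : ∀ i, RootSystem p (algebraMap A S (f i)))
    (G : ∀ i, RootSystem p (algebraMap A S (g i))) (t s : ℝ) : Ideal A :=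
  ⨆ (ε : ℝ) (_ : 0 < ε), tauSharpMixed d F G (t + ε) (s + ε)

/-- The monomials of degree `n` in the `f i`, indexed by the multisets of `n` indices. -/
def monomials (f : ι → A) (n : ℕ) (m : Sym ι n) : A :=
  ((m : Multiset ι).map f).prod

/-- The products of the chosen roots of the `f i`, as roots of the monomials in the `f i`. -/
def monomialRoots (F : ∀ i, RootSystem p (algebraMap A S (f i))) (n : ℕ) (m : Sym ι n) :
    RootSystem p (algebraMap A S (monomials f n m)) where
  root e := ((m : Multiset ι).map fun i => (F i).root e).prod
  root_zero := by
    simp only [monomials, (F _).root_zero, map_multiset_prod, Multiset.map_map,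
      Function.comp_def]
  root_succ_pow e := by
    simp only [← Multiset.prod_map_pow, (F _).root_succ_pow]

end TestIdeals

end PerfectoidTest

end

-- Write S for A_∞, H for H^d_𝔪(A) and 0^Λ for `zeroStar` of a set Λ ⊆ S. The theorem combines a
-- duality on H with almost flatness of S, and the core statement
-- `IsMatlis.annihilator_zeroStar_le_mul` concerns arbitrary sets Λ, Λ'.
--
-- Duality. Since A is regular, H behaves like the injective hull of the residue field: for regular
-- parameters x₁, …, x_d the part of H killed by q_t = (x₁^{t+1}, …, x_d^{t+1}) is isomorphic to
-- A/q_t (`nonempty_torsionBySet_limExt_equiv`). Counting lengths gives Ann_A Ann_H I = I for every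
-- ideal I; completeness, through Chevalley's theorem, gives Ann_H Ann_A N = N for every submodule
-- N.
--
-- Almost flatness. Tensoring with S almost preserves injections. By dimension shifting S ⊗ Ext^i(M,
-- A) → Ext^i(M, S) is almost injective for finite M, and in the limit over M = A/𝔪^t so is S ⊗ H →
-- H^d_𝔪(S). Vanishing in H^d_𝔪(S) can therefore be tested, almost, in S ⊗ H.
--
-- Core. Let I = Ann 0^Λ and J = Ann 0^Λ'. By duality, a ∈ IJ once a kills every η with IJη = 0, so
-- it suffices that each such η is almost killed by all yz with y ∈ Λ, z ∈ Λ'. For b ∈ J the element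
-- bη is killed by I, hence lies in 0^Λ by duality, and y ⊗ bη is almost zero. If b₁, …, b_r
-- generate J, the map θ ↦ (b_iθ) embeds H/Ann_H J = H/0^Λ' into H^r. Almost flatness then puts y ⊗
-- η, up to roots of p, in the image of S ⊗ 0^Λ', which z almost kills in H^d_𝔪(S).
--
-- The inequality for τ is the one for τ♯ at exponents t+ε, s+ε. The statements on powers and
-- monomials are combinatorial: replacing each f^{1/p^e} by p^j factors f^{1/p^{e+j}} makes products
-- divisible enough that rounding errors are absorbed by ε.

universe v w

noncomputable section

namespace PerfectoidTest

open Limits Opposite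

/-! ### Morphisms from homology to an injective object, as classes of cocycles. -/

section HomologyHom

variable {D : Type w} [Category.{v} D] [Abelian D] {I : D}

/-- The morphism out of the homology of `K` induced by a cocycle with values in `I`. -/
def homologyDesc (K : ChainComplex D ℕ) {n : ℕ} (k : K.X n ⟶ I) (hk : K.d (n + 1) n ≫ k = 0) :
    K.homology n ⟶ I :=
  K.homologyι n ≫ K.descOpcycles k (n + 1) (by simp) hk

/-- Homology is a subobject of the opcycles, so injectivity of `I` extends a morphism to the
opcycles. With `homologyDesc_eq_zero_iff` this says that Hom(-, I) commutes with homology. -/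
theorem homologyDesc_surjective [Injective I] (K : ChainComplex D ℕ) {n : ℕ}
    (h : K.homology n ⟶ I) : ∃ k hk, homologyDesc K (n := n) k hk = h := by
  refine ⟨K.pOpcycles n ≫ Injective.factorThru h (K.homologyι n), by simp, ?_⟩
  have : K.descOpcycles (K.pOpcycles n ≫ Injective.factorThru h (K.homologyι n)) (n + 1)
      (by simp) (by simp) = Injective.factorThru h (K.homologyι n) := by
    rw [← cancel_epi (K.pOpcycles n), HomologicalComplex.p_descOpcycles]
  rw [homologyDesc, this, Injective.comp_factorThru]

/-- Homology is the kernel of `K.fromOpcycles`. A morphism on opcycles that vanishes there factors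
through the differential, because `I` is injective. -/
theorem homologyDesc_eq_zero_iff [Injective I] (K : ChainComplex D ℕ) {n : ℕ}
    (k : K.X (n + 1) ⟶ I) (hk : K.d (n + 1 + 1) (n + 1) ≫ k = 0) :
    homologyDesc K k hk = 0 ↔ ∃ b : K.X n ⟶ I, K.d (n + 1) n ≫ b = k := by
  constructor
  · intro h
    let S : ShortComplex D := ShortComplex.mk (K.homologyι (n + 1)) (K.fromOpcycles (n + 1) n)
      (by simp)
    have hS : S.Exact := ShortComplex.exact_of_f_is_kernel _
      (K.homologyIsKernel (n + 1) n (by simp))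
    let e := hS.descToInjective (K.descOpcycles k (n + 1 + 1) (by simp) hk) h
    have he : K.fromOpcycles (n + 1) n ≫ e = _ := hS.comp_descToInjective _ _
    refine ⟨e, ?_⟩
    rw [← K.p_fromOpcycles, Category.assoc, he, HomologicalComplex.p_descOpcycles]
  · rintro ⟨b, rfl⟩
    have : K.descOpcycles (K.d (n + 1) n ≫ b) (n + 1 + 1) (by simp) hk =
        K.fromOpcycles (n + 1) n ≫ b := by
      rw [← cancel_epi (K.pOpcycles (n + 1))]; simp
    rw [homologyDesc, this]; simp

theorem homologyDesc_comp {K L : ChainComplex D ℕ} (φ : K ⟶ L) {n : ℕ}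
    (k : L.X n ⟶ I) (hk : L.d (n + 1) n ≫ k = 0) :
    HomologicalComplex.homologyMap φ n ≫ homologyDesc L k hk =
      homologyDesc K (φ.f n ≫ k) (by rw [← φ.comm_assoc, hk, comp_zero]) := by
  rw [homologyDesc, homologyDesc, HomologicalComplex.homologyι_naturality_assoc]
  congr 1
  rw [← cancel_epi (K.pOpcycles n)]
  simp

theorem homologyDesc_sub (K : ChainComplex D ℕ) {n : ℕ} (k l : K.X n ⟶ I)
    (hk : K.d (n + 1) n ≫ k = 0) (hl : K.d (n + 1) n ≫ l = 0) :
    homologyDesc K k hk - homologyDesc K l hl =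
      homologyDesc K (k - l) (by rw [Preadditive.comp_sub, hk, hl, sub_zero]) := by
  rw [homologyDesc, homologyDesc, homologyDesc, ← Preadditive.comp_sub]
  congr 1
  rw [← cancel_epi (K.pOpcycles n)]
  simp

end HomologyHom

/-! ### Ext as a derived functor agrees with Ext in the derived category, in positive degrees. -/

section OldExt

variable {R : Type u} [CommRing R]

/-- `R` is projective over itself. Morphisms to its opposite are elements of the underlying module,
so the previous section describes elements of the derived functor Ext by cocycles. -/
instance : Injective (op (ModuleCat.of R R)) := inferInstance

variable {X X' Y Y' : ModuleCat.{u} R} (P : ProjectiveResolution X) (P' : ProjectiveResolution X')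
  {n : ℕ}

/-- The functor `Hom(-, Y)`, as a covariant functor to the opposite category. -/
abbrev homTo (Y : ModuleCat.{u} R) : ModuleCat.{u} R ⥤ (ModuleCat.{u} R)ᵒᵖ :=
  ((linearYoneda R (ModuleCat.{u} R)).obj Y).rightOp

/-- Elements of the module `Hom(Z, Y)` as morphisms in the opposite category. -/
def homToElt {Z : ModuleCat.{u} R} (c : Z ⟶ Y) : (homTo Y).obj Z ⟶ op (ModuleCat.of R R) :=
  Quiver.Hom.op (ModuleCat.ofHom (LinearMap.toSpanSingleton R (Z ⟶ Y) c))

theorem homTo_map_homToElt {Z Z' : ModuleCat.{u} R} (f : Z ⟶ Z') (c : Z' ⟶ Y) :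
    (homTo Y).map f ≫ homToElt c = homToElt (f ≫ c) := by
  apply Quiver.Hom.unop_inj
  ext
  change f ≫ ((1 : R) • c) = (1 : R) • (f ≫ c)
  simp

theorem homToElt_surjective {Z : ModuleCat.{u} R} (h : (homTo Y).obj Z ⟶ op (ModuleCat.of R R)) :
    ∃ c, homToElt c = h := by
  refine ⟨h.unop.hom (1 : R), ?_⟩
  apply Quiver.Hom.unop_inj
  ext
  change (1 : R) • h.unop.hom (1 : R) = h.unop.hom (1 : R)
  simp

theorem homToElt_injective {Z : ModuleCat.{u} R} :
    Function.Injective (homToElt : (Z ⟶ Y) → _) := by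
  intro c c' h
  have : (1 : R) • c = (1 : R) • c' :=
    congrArg (fun h : (homTo Y).obj Z ⟶ op (ModuleCat.of R R) => h.unop.hom (1 : R)) h
  simpa using this

theorem homToElt_zero {Z : ModuleCat.{u} R} : homToElt (0 : Z ⟶ Y) = 0 := by
  apply Quiver.Hom.unop_inj
  ext
  change (1 : R) • (0 : Z ⟶ Y) = 0
  simp

theorem homToElt_sub {Z : ModuleCat.{u} R} (c c' : Z ⟶ Y) :
    homToElt c - homToElt c' = homToElt (c - c') := by
  apply Quiver.Hom.unop_inj
  ext
  change (1 : R) • c - (1 : R) • c' = (1 : R) • (c - c')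
  simp

/-- The complex `Hom(P, Y)` in the opposite category. -/
def homToComplex (Y : ModuleCat.{u} R) : ChainComplex (ModuleCat.{u} R)ᵒᵖ ℕ :=
  ((homTo Y).mapHomologicalComplex _).obj P.complex

/-- The functoriality of `homToComplex` in the second variable. -/
def homToComplexMap (f : Y ⟶ Y') : homToComplex P Y' ⟶ homToComplex P Y :=
  (NatTrans.mapHomologicalComplex
    (NatTrans.rightOp ((linearYoneda R (ModuleCat.{u} R)).map f)) _).app P.complex

variable {P P'} in
/-- The functoriality of `homToComplex` in the resolution. -/
def homToComplexMapLeft (φ : P'.complex ⟶ P.complex) (Y : ModuleCat.{u} R) :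
    homToComplex P' Y ⟶ homToComplex P Y :=
  ((homTo Y).mapHomologicalComplex _).map φ

/-- The derived functor `Ext` as the homology of `homToComplex`, in the opposite category. -/
def derivedExtIso (Y : ModuleCat.{u} R) (n : ℕ) :
    ((homTo Y).leftDerived n).obj X ≅ (homToComplex P Y).homology n :=
  P.isoLeftDerivedObj (homTo Y) n

theorem derivedExtIso_natural (f : Y ⟶ Y') (n : ℕ) :
    (NatTrans.leftDerived (NatTrans.rightOp ((linearYoneda R (ModuleCat.{u} R)).map f)) n).app X =
      (derivedExtIso P Y' n).hom ≫ HomologicalComplex.homologyMap (homToComplexMap P f) n ≫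
        (derivedExtIso P Y n).inv :=
  ProjectiveResolution.leftDerived_app_eq
    (NatTrans.rightOp ((linearYoneda R (ModuleCat.{u} R)).map f)) P n

theorem derivedExtIso_natural_left {f : X' ⟶ X} (φ : P'.Hom P f) (n : ℕ) :
    ((homTo Y).leftDerived n).map f ≫ (derivedExtIso P Y n).hom =
      (derivedExtIso P' Y n).hom ≫ HomologicalComplex.homologyMap
        (homToComplexMapLeft φ.hom Y) n :=
  ProjectiveResolution.isoLeftDerivedObj_hom_naturality f P' P φ.hom
    (by simpa using φ.hom_f_zero_comp_π_f_zero) (homTo Y) n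

/-- A cochain in `Hom(P, Y)` as a morphism in the opposite category. -/
def cochainElt (c : P.complex.X n ⟶ Y) : (homToComplex P Y).X n ⟶ op (ModuleCat.of R R) :=
  homToElt c

theorem cochainElt_surjective (h : (homToComplex P Y).X n ⟶ op (ModuleCat.of R R)) :
    ∃ c, cochainElt P c = h :=
  homToElt_surjective h

theorem cochainElt_injective :
    Function.Injective (cochainElt P : (P.complex.X n ⟶ Y) → _) :=
  homToElt_injective

theorem cochainElt_zero : cochainElt P (0 : P.complex.X n ⟶ Y) = 0 :=
  homToElt_zero

theorem cochainElt_sub (c c' : P.complex.X n ⟶ Y) :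
    cochainElt P (c - c') = cochainElt P c - cochainElt P c' :=
  (homToElt_sub c c').symm

theorem homToComplex_d_cochainElt (i j : ℕ) (c : P.complex.X j ⟶ Y) :
    (homToComplex P Y).d i j ≫ cochainElt P c = cochainElt P (P.complex.d i j ≫ c) :=
  homTo_map_homToElt _ _

theorem homToComplexMapLeft_cochainElt (φ : P'.complex ⟶ P.complex) (c : P.complex.X n ⟶ Y) :
    (homToComplexMapLeft φ Y).f n ≫ cochainElt P c = cochainElt P' (φ.f n ≫ c) :=
  homTo_map_homToElt _ _

theorem homToComplexMap_cochainElt (f : Y ⟶ Y') (c : P.complex.X n ⟶ Y) :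
    (homToComplexMap P f).f n ≫ cochainElt P c = cochainElt P (c ≫ f) := by
  apply Quiver.Hom.unop_inj
  ext
  change ((1 : R) • c) ≫ f = (1 : R) • (c ≫ f)
  simp

theorem homToComplex_d_cochainElt_eq_zero (c : P.complex.X n ⟶ Y)
    (hc : P.complex.d (n + 1) n ≫ c = 0) :
    (homToComplex P Y).d (n + 1) n ≫ cochainElt P c = 0 := by
  rw [homToComplex_d_cochainElt, hc, cochainElt_zero]

/-- Elements of the derived functor `Ext` as morphisms in the opposite category. -/
def derivedExtElt (h : ((homTo Y).leftDerived n).obj X ⟶ op (ModuleCat.of R R)) :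
    ((Ext R (ModuleCat.{u} R) n).obj (op X)).obj Y :=
  h.unop.hom (1 : R)

theorem derivedExtElt_surjective (e : ((Ext R (ModuleCat.{u} R) n).obj (op X)).obj Y) :
    ∃ h, derivedExtElt h = e :=
  ⟨Quiver.Hom.op (ModuleCat.ofHom (LinearMap.toSpanSingleton R
    (((Ext R (ModuleCat.{u} R) n).obj (op X)).obj Y) e)), one_smul R e⟩

theorem derivedExtElt_injective : Function.Injective
    (derivedExtElt : (((homTo Y).leftDerived n).obj X ⟶ op (ModuleCat.of R R)) → _) := by
  intro h h' hh
  apply Quiver.Hom.unop_inj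
  ext
  exact hh

theorem derivedExtElt_sub (h h' : ((homTo Y).leftDerived n).obj X ⟶ op (ModuleCat.of R R)) :
    derivedExtElt (h - h') = derivedExtElt h - derivedExtElt h' :=
  rfl

theorem derivedExtElt_zero :
    derivedExtElt (0 : ((homTo Y).leftDerived n).obj X ⟶ op (ModuleCat.of R R)) = 0 :=
  rfl

theorem map_derivedExtElt (h : ((homTo Y).leftDerived n).obj X ⟶ op (ModuleCat.of R R))
    (f : Y ⟶ Y') :
    (((Ext R (ModuleCat.{u} R) n).obj (op X)).map f).hom (derivedExtElt h) = derivedExtElt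
      ((NatTrans.leftDerived (NatTrans.rightOp
        ((linearYoneda R (ModuleCat.{u} R)).map f)) n).app X ≫ h) :=
  rfl

theorem map_op_derivedExtElt (h : ((homTo Y).leftDerived n).obj X ⟶ op (ModuleCat.of R R))
    (f : X' ⟶ X) :
    (((Ext R (ModuleCat.{u} R) n).map f.op).app Y).hom (derivedExtElt h) = derivedExtElt
      (((homTo Y).leftDerived n).map f ≫ h) :=
  rfl

/-- The class of a cocycle in the derived functor `Ext`. -/
def derivedExtMk (c : P.complex.X n ⟶ Y) (hc : P.complex.d (n + 1) n ≫ c = 0) :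
    ((Ext R (ModuleCat.{u} R) n).obj (op X)).obj Y :=
  derivedExtElt ((derivedExtIso P Y n).hom ≫
    homologyDesc (homToComplex P Y) (cochainElt P c) (homToComplex_d_cochainElt_eq_zero P c hc))

theorem derivedExtMk_surjective (e : ((Ext R (ModuleCat.{u} R) n).obj (op X)).obj Y) :
    ∃ c hc, derivedExtMk P (n := n) c hc = e := by
  obtain ⟨h, rfl⟩ := derivedExtElt_surjective e
  obtain ⟨k, hk, hkh⟩ := homologyDesc_surjective (homToComplex P Y)
    ((derivedExtIso P Y n).inv ≫ h)
  obtain ⟨c, rfl⟩ := cochainElt_surjective P k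
  refine ⟨c, ?_, ?_⟩
  · apply cochainElt_injective
    rw [← homToComplex_d_cochainElt, cochainElt_zero, hk]
  · rw [derivedExtMk, hkh, Iso.hom_inv_id_assoc]

theorem derivedExtMk_eq_zero_iff (c : P.complex.X (n + 1) ⟶ Y)
    (hc : P.complex.d (n + 1 + 1) (n + 1) ≫ c = 0) :
    derivedExtMk P c hc = 0 ↔ ∃ b : P.complex.X n ⟶ Y, P.complex.d (n + 1) n ≫ b = c := by
  rw [derivedExtMk, ← derivedExtElt_zero, derivedExtElt_injective.eq_iff,
    ← comp_zero (f := (derivedExtIso P Y (n + 1)).hom), cancel_epi, homologyDesc_eq_zero_iff]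
  constructor
  · rintro ⟨b, hb⟩
    obtain ⟨b, rfl⟩ := cochainElt_surjective P b
    refine ⟨b, cochainElt_injective P ?_⟩
    rw [← homToComplex_d_cochainElt, hb]
  · rintro ⟨b, rfl⟩
    exact ⟨cochainElt P b, homToComplex_d_cochainElt P _ _ _⟩

theorem derivedExtMk_sub (c c' : P.complex.X n ⟶ Y) (hc : P.complex.d (n + 1) n ≫ c = 0)
    (hc' : P.complex.d (n + 1) n ≫ c' = 0) :
    derivedExtMk P c hc - derivedExtMk P c' hc' =
      derivedExtMk P (c - c') (by rw [Preadditive.comp_sub, hc, hc', sub_zero]) := by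
  simp only [derivedExtMk, cochainElt_sub]
  rw [← homologyDesc_sub _ _ _ (homToComplex_d_cochainElt_eq_zero P c hc)
    (homToComplex_d_cochainElt_eq_zero P c' hc'), Preadditive.comp_sub, derivedExtElt_sub]

theorem map_derivedExtMk (c : P.complex.X n ⟶ Y) (hc : P.complex.d (n + 1) n ≫ c = 0)
    (f : Y ⟶ Y') :
    (((Ext R (ModuleCat.{u} R) n).obj (op X)).map f).hom (derivedExtMk P c hc) =
      derivedExtMk P (c ≫ f) (by rw [reassoc_of% hc, zero_comp]) := by
  rw [derivedExtMk, map_derivedExtElt, derivedExtIso_natural P]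
  simp only [Category.assoc, Iso.inv_hom_id_assoc, homologyDesc_comp, homToComplexMap_cochainElt]
  rfl

variable {P P'} in
theorem map_op_derivedExtMk (c : P.complex.X n ⟶ Y) (hc : P.complex.d (n + 1) n ≫ c = 0)
    {f : X' ⟶ X} (φ : P'.Hom P f) :
    (((Ext R (ModuleCat.{u} R) n).map f.op).app Y).hom (derivedExtMk P c hc) =
      derivedExtMk P' (φ.hom.f n ≫ c) (by rw [← φ.hom.comm_assoc, hc, comp_zero]) := by
  rw [derivedExtMk, map_op_derivedExtElt, ← Category.assoc, derivedExtIso_natural_left P P' φ]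
  simp only [Category.assoc, homologyDesc_comp, homToComplexMapLeft_cochainElt]
  rfl

/-- The comparison between the two definitions of `Ext`. -/
def extToDerivedExt (e : Abelian.Ext.{u} X Y n) : ((Ext R (ModuleCat.{u} R) n).obj (op X)).obj Y :=
  derivedExtMk (projectiveResolution X)
    ((projectiveResolution X).extMk_surjective e (n + 1) rfl).choose
    ((projectiveResolution X).extMk_surjective e (n + 1) rfl).choose_spec.choose

/-- In both theories a cocycle has class zero exactly when it is a coboundary, here from degree `n`.
Hence `extToDerivedExt` does not depend on the chosen cocycle and is injective. -/
theorem extMk_eq_iff (c c' : P.complex.X (n + 1) ⟶ Y)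
    (hc : P.complex.d (n + 1 + 1) (n + 1) ≫ c = 0)
    (hc' : P.complex.d (n + 1 + 1) (n + 1) ≫ c' = 0) :
    P.extMk c _ rfl hc = P.extMk c' _ rfl hc' ↔ derivedExtMk P c hc = derivedExtMk P c' hc' := by
  rw [← sub_eq_zero, P.sub_extMk, ← sub_eq_zero (a := derivedExtMk P c hc), derivedExtMk_sub,
    derivedExtMk_eq_zero_iff, ← P.extMk_eq_zero_iff _ (n + 1 + 1) rfl _ n rfl]

theorem extToDerivedExt_extMk (c : (projectiveResolution X).complex.X (n + 1) ⟶ Y)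
    (hc : (projectiveResolution X).complex.d (n + 1 + 1) (n + 1) ≫ c = 0) :
    extToDerivedExt ((projectiveResolution X).extMk c _ rfl hc) =
      derivedExtMk (projectiveResolution X) c hc :=
  (extMk_eq_iff _ _ _ _ _).mp ((projectiveResolution X).extMk_surjective
    ((projectiveResolution X).extMk c _ rfl hc) (n + 1 + 1) rfl).choose_spec.choose_spec

theorem extToDerivedExt_bijective : Function.Bijective
    (extToDerivedExt : Abelian.Ext.{u} X Y (n + 1) → _) := by
  constructor
  · intro e e' h
    obtain ⟨c, hc, rfl⟩ := (projectiveResolution X).extMk_surjective e (n + 1 + 1) rfl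
    obtain ⟨c', hc', rfl⟩ := (projectiveResolution X).extMk_surjective e' (n + 1 + 1) rfl
    rwa [extToDerivedExt_extMk, extToDerivedExt_extMk, ← extMk_eq_iff] at h
  · intro e
    obtain ⟨c, hc, rfl⟩ := derivedExtMk_surjective (projectiveResolution X) e
    exact ⟨(projectiveResolution X).extMk c _ rfl hc, extToDerivedExt_extMk c hc⟩

theorem extToDerivedExt_sub (e e' : Abelian.Ext.{u} X Y (n + 1)) :
    extToDerivedExt (e - e') = extToDerivedExt e - extToDerivedExt e' := by
  obtain ⟨c, hc, rfl⟩ := (projectiveResolution X).extMk_surjective e (n + 1 + 1) rfl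
  obtain ⟨c', hc', rfl⟩ := (projectiveResolution X).extMk_surjective e' (n + 1 + 1) rfl
  rw [ProjectiveResolution.sub_extMk, extToDerivedExt_extMk, extToDerivedExt_extMk, extToDerivedExt_extMk,
    derivedExtMk_sub]

theorem map_extToDerivedExt (e : Abelian.Ext.{u} X Y (n + 1)) (f : Y ⟶ Y') :
    (((Ext R (ModuleCat.{u} R) (n + 1)).obj (op X)).map f).hom (extToDerivedExt e) =
      extToDerivedExt (e.comp (Abelian.Ext.mk₀ f) (add_zero _)) := by
  obtain ⟨c, hc, rfl⟩ := (projectiveResolution X).extMk_surjective e (n + 1 + 1) rfl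
  rw [ProjectiveResolution.extMk_comp_mk₀, extToDerivedExt_extMk, extToDerivedExt_extMk, map_derivedExtMk]

theorem map_op_extToDerivedExt (e : Abelian.Ext.{u} X Y (n + 1)) (f : X' ⟶ X) :
    (((Ext R (ModuleCat.{u} R) (n + 1)).map f.op).app Y).hom (extToDerivedExt e) =
      extToDerivedExt ((Abelian.Ext.mk₀ f).comp e (zero_add _)) := by
  obtain ⟨c, hc, rfl⟩ := (projectiveResolution X).extMk_surjective e (n + 1 + 1) rfl
  let φ : (projectiveResolution X').Hom (projectiveResolution X) f :=
    { hom := ProjectiveResolution.lift f _ _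
      hom_f_zero_comp_π_f_zero :=
        HomologicalComplex.congr_hom (ProjectiveResolution.lift_commutes f _ _) 0 }
  rw [ProjectiveResolution.mk₀_comp_extMk _ _ _ _ φ, extToDerivedExt_extMk,
    extToDerivedExt_extMk, map_op_derivedExtMk]

end OldExt
end PerfectoidTest
end

noncomputable section

namespace PerfectoidTest

open Limits Opposite

/-! ### Linearity of the comparison of the two Ext modules. -/

section Smul

variable {R : Type u} [CommRing R] {X Y : ModuleCat.{u} R} (P : ProjectiveResolution X) {n : ℕ}

/-- Multiplication by `r` on `R`, in the opposite category. -/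
def scalarOp (r : R) : op (ModuleCat.of R R) ⟶ op (ModuleCat.of R R) :=
  Quiver.Hom.op (ModuleCat.ofHom (LinearMap.lsmul R R r))

theorem derivedExtElt_comp_scalarOp (r : R)
    (h : ((homTo Y).leftDerived n).obj X ⟶ op (ModuleCat.of R R)) :
    derivedExtElt (h ≫ scalarOp r) = r • derivedExtElt h :=
  h.unop.hom.map_smul r 1

theorem cochainElt_comp_scalarOp (r : R) (c : P.complex.X n ⟶ Y) :
    cochainElt P c ≫ scalarOp r = cochainElt P (r • c) := by
  apply Quiver.Hom.unop_inj
  ext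
  change (r • (1 : R)) • c = (1 : R) • (r • c)
  simp

theorem derivedExtMk_smul (r : R) (c : P.complex.X n ⟶ Y)
    (hc : P.complex.d (n + 1) n ≫ c = 0) :
    derivedExtMk P (r • c) (by rw [Linear.comp_smul, hc, smul_zero]) =
      r • derivedExtMk P c hc := by
  rw [derivedExtMk, derivedExtMk, ← derivedExtElt_comp_scalarOp]
  congr 1
  rw [Category.assoc, homologyDesc, homologyDesc, Category.assoc]
  congr 2
  rw [← cancel_epi ((homToComplex P Y).pOpcycles n)]
  simp [cochainElt_comp_scalarOp]

theorem extToDerivedExt_smul (r : R) (e : Abelian.Ext.{u} X Y (n + 1)) :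
    extToDerivedExt (r • e) = r • extToDerivedExt e := by
  obtain ⟨c, hc, rfl⟩ := (projectiveResolution X).extMk_surjective e (n + 1 + 1) rfl
  rw [Abelian.Ext.smul_eq_comp_mk₀, ProjectiveResolution.extMk_comp_mk₀, extToDerivedExt_extMk,
    extToDerivedExt_extMk, ← derivedExtMk_smul]
  simp

variable (X Y n) in
/-- The comparison between the two definitions of `Ext` in positive degrees, as a linear map. -/
def extEquivDerivedExt : Abelian.Ext.{u} X Y (n + 1) →ₗ[R]
    ((Ext R (ModuleCat.{u} R) (n + 1)).obj (op X)).obj Y where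
  toFun := extToDerivedExt
  map_add' e e' := by
    -- Additivity follows from compatibility with differences, as e + e' = e - (0 - e').
    have h0 : extToDerivedExt (0 : Abelian.Ext.{u} X Y (n + 1)) = 0 := by
      simpa using extToDerivedExt_sub (0 : Abelian.Ext.{u} X Y (n + 1)) 0
    have h1 := extToDerivedExt_sub 0 e'
    have h2 := extToDerivedExt_sub e (0 - e')
    rw [h1, h0] at h2
    simpa using h2
  map_smul' := extToDerivedExt_smul

end Smul

/-! ### The direct limit of Ext^i(R/J^t, N), which computes local cohomology. -/

section LimExt

variable {R : Type u} [CommRing R] (J : Ideal R)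

/-- The module `R / J ^ t`. -/
abbrev powQuot (t : ℕ) : ModuleCat.{u} R :=
  (localCohomology.ringModIdeals (localCohomology.idealPowersDiagram J)).obj (op t)

/-- The projection `R / J ^ t → R / J ^ s` for `s ≤ t`. -/
abbrev powQuotMap {s t : ℕ} (h : s ≤ t) : powQuot J t ⟶ powQuot J s :=
  (localCohomology.ringModIdeals (localCohomology.idealPowersDiagram J)).map (homOfLE h).op

theorem powQuotMap_comp {r s t : ℕ} (h : r ≤ s) (h' : s ≤ t) :
    powQuotMap J h' ≫ powQuotMap J h = powQuotMap J (h.trans h') := by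
  rw [powQuotMap, powQuotMap, ← Functor.map_comp]
  rfl

theorem powQuotMap_refl (s : ℕ) : powQuotMap J (le_refl s) = 𝟙 _ :=
  CategoryTheory.Functor.map_id _ _

/-- The transition map `Ext^i(R / J ^ s, N) → Ext^i(R / J ^ t, N)`. -/
def extTransition (i : ℕ) (N : ModuleCat.{u} R) (s t : ℕ) (h : s ≤ t) :
    Abelian.Ext.{u} (powQuot J s) N i →ₗ[R] Abelian.Ext.{u} (powQuot J t) N i :=
  (Abelian.Ext.mk₀ (powQuotMap J h)).precompOfLinear R N (zero_add i)

theorem extTransition_apply {i : ℕ} {N : ModuleCat.{u} R} {s t : ℕ} (h : s ≤ t)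
    (e : Abelian.Ext.{u} (powQuot J s) N i) :
    extTransition J i N s t h e = (Abelian.Ext.mk₀ (powQuotMap J h)).comp e (zero_add i) :=
  rfl

instance (i : ℕ) (N : ModuleCat.{u} R) :
    DirectedSystem (fun t => Abelian.Ext.{u} (powQuot J t) N i)
      (fun s t h => extTransition J i N s t h) where
  map_self s x := by
    rw [extTransition_apply, powQuotMap_refl, Abelian.Ext.mk₀_id_comp]
  map_map {r s t} h h' x := by
    rw [extTransition_apply, extTransition_apply, extTransition_apply,
      Abelian.Ext.mk₀_comp_mk₀_assoc, powQuotMap_comp]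

/-- The direct limit of the `Ext^i(R / J ^ t, N)`. -/
abbrev limExt (i : ℕ) (N : ModuleCat.{u} R) : Type u :=
  Module.DirectLimit (fun t => Abelian.Ext.{u} (powQuot J t) N i) (extTransition J i N)

/-- The canonical map from `Ext^i(R / J ^ t, N)` to the direct limit. -/
abbrev toLimExt (i : ℕ) (N : ModuleCat.{u} R) (t : ℕ) :
    Abelian.Ext.{u} (powQuot J t) N i →ₗ[R] limExt J i N :=
  Module.DirectLimit.of R ℕ (fun t => Abelian.Ext.{u} (powQuot J t) N i) (extTransition J i N) t

variable {J}

theorem exists_toLimExt {i : ℕ} {N : ModuleCat.{u} R} (x : limExt J i N) :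
    ∃ t e, toLimExt J i N t e = x :=
  Module.DirectLimit.exists_of x

theorem toLimExt_transition {i : ℕ} {N : ModuleCat.{u} R} {s t : ℕ} (h : s ≤ t)
    (e : Abelian.Ext.{u} (powQuot J s) N i) :
    toLimExt J i N t ((Abelian.Ext.mk₀ (powQuotMap J h)).comp e (zero_add i)) =
      toLimExt J i N s e := by
  rw [← extTransition_apply]
  exact Module.DirectLimit.of_f

theorem toLimExt_eq_zero {i : ℕ} {N : ModuleCat.{u} R} {s : ℕ}
    {e : Abelian.Ext.{u} (powQuot J s) N i} (he : toLimExt J i N s e = 0) :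
    ∃ t, ∃ h : s ≤ t, (Abelian.Ext.mk₀ (powQuotMap J h)).comp e (zero_add i) = 0 :=
  Module.DirectLimit.of.zero_exact he

/-- The functoriality of `limExt`. -/
def limExtMap (i : ℕ) {N N' : ModuleCat.{u} R} (f : N ⟶ N') : limExt J i N →ₗ[R] limExt J i N' :=
  Module.DirectLimit.map
    (fun t => (Abelian.Ext.mk₀ f).postcompOfLinear R (powQuot J t) (add_zero i)) (by
      intro s t h
      ext e
      exact Abelian.Ext.comp_assoc_of_third_deg_zero _ _ _ (zero_add i))

theorem limExtMap_toLimExt {i : ℕ} {N N' : ModuleCat.{u} R} (f : N ⟶ N') (t : ℕ)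
    (e : Abelian.Ext.{u} (powQuot J t) N i) :
    limExtMap i f (toLimExt J i N t e) =
      toLimExt J i N' t (e.comp (Abelian.Ext.mk₀ f) (add_zero i)) :=
  Module.DirectLimit.map_apply_of _ _ _

/-- Multiplication by `r` on Ext is induced by multiplication by `r` on R/J^t, which is zero. -/
theorem mem_pow_smul_toLimExt {i : ℕ} {N : ModuleCat.{u} R} (t : ℕ)
    (e : Abelian.Ext.{u} (powQuot J t) N i) {r : R} (hr : r ∈ J ^ t) :
    r • toLimExt J i N t e = 0 := by
  have h1 : r • e = (Abelian.Ext.mk₀ (r • 𝟙 (powQuot J t))).comp e (zero_add i) := by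
    simp [Abelian.Ext.mk₀_smul]
  have h2 : r • 𝟙 (powQuot J t) = 0 := by
    ext (x : R ⧸ J ^ t)
    obtain ⟨x, rfl⟩ := Ideal.Quotient.mk_surjective x
    change Ideal.Quotient.mk (J ^ t) (r * x) = 0
    exact Ideal.Quotient.eq_zero_iff_mem.mpr (Ideal.mul_mem_right _ _ hr)
  rw [← map_smul, h1, h2]
  simp

theorem exists_pow_smul_limExt_eq_zero {i : ℕ} {N : ModuleCat.{u} R} (x : limExt J i N) :
    ∃ t, ∀ r ∈ J ^ t, r • x = 0 := by
  obtain ⟨t, e, rfl⟩ := exists_toLimExt x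
  exact ⟨t, fun r hr => mem_pow_smul_toLimExt t e hr⟩

/-! ### Local cohomology as a direct limit -/

instance : PreservesColimitsOfShape ℕᵒᵖᵒᵖ (forget (ModuleCat.{u} R)) :=
  have : PreservesFilteredColimitsOfSize.{0, 0} (forget (ModuleCat.{u} R)) :=
    preservesFilteredColimitsOfSize_shrink.{0, u, 0, u} _
  PreservesFilteredColimitsOfSize.preserves_filtered_colimits _

theorem isColimit_evaluation (i : ℕ) (N : ModuleCat.{u} R) :
    Nonempty (IsColimit (((evaluation _ _).obj N).mapCocone (colimit.cocone
      (localCohomology.diagram (localCohomology.idealPowersDiagram J) i)))) :=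
  ⟨isColimitOfPreserves _ (colimit.isColimit _)⟩

variable (J) in
/-- The canonical map from the derived functor `Ext` to local cohomology. -/
def derivedExtToLocalCohomology (i : ℕ) (N : ModuleCat.{u} R) (t : ℕ) :
    ((Ext R (ModuleCat.{u} R) i).obj (op (powQuot J t))).obj N →ₗ[R]
      (localCohomology J i).obj N :=
  ((colimit.ι (localCohomology.diagram (localCohomology.idealPowersDiagram J) i)
    (op (op t))).app N).hom

theorem derivedExtToLocalCohomology_transition {i : ℕ} {N : ModuleCat.{u} R} {s t : ℕ} (h : s ≤ t)
    (e : ((Ext R (ModuleCat.{u} R) i).obj (op (powQuot J s))).obj N) :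
    derivedExtToLocalCohomology J i N t
      ((((Ext R (ModuleCat.{u} R) i).map (powQuotMap J h).op).app N).hom e) =
      derivedExtToLocalCohomology J i N s e := by
  have := colimit.w (localCohomology.diagram (localCohomology.idealPowersDiagram J) i)
    (homOfLE h).op.op
  exact congrArg (fun φ : (localCohomology.diagram (localCohomology.idealPowersDiagram J) i).obj
    (op (op s)) ⟶ colimit (localCohomology.diagram (localCohomology.idealPowersDiagram J) i) =>
    (φ.app N).hom e) this

theorem exists_derivedExtToLocalCohomology {i : ℕ} {N : ModuleCat.{u} R}
    (x : (localCohomology J i).obj N) : ∃ t e, derivedExtToLocalCohomology J i N t e = x := by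
  obtain ⟨h⟩ := isColimit_evaluation (J := J) i N
  obtain ⟨t, e, he⟩ := Concrete.isColimit_exists_rep _ h x
  exact ⟨t.unop.unop, e, he⟩

theorem derivedExtToLocalCohomology_eq_zero {i : ℕ} {N : ModuleCat.{u} R} {s : ℕ}
    {e : ((Ext R (ModuleCat.{u} R) i).obj (op (powQuot J s))).obj N}
    (he : derivedExtToLocalCohomology J i N s e = 0) : ∃ t, ∃ h : s ≤ t,
      (((Ext R (ModuleCat.{u} R) i).map (powQuotMap J h).op).app N).hom e = 0 := by
  obtain ⟨h⟩ := isColimit_evaluation (J := J) i N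
  obtain ⟨t, f, hf⟩ := (IsColimit.eq_iff' h e 0).mp (by
    refine he.trans (map_zero (derivedExtToLocalCohomology J i N s)).symm)
  refine ⟨t.unop.unop, leOfHom f.unop.unop, ?_⟩
  refine Eq.trans hf ?_
  exact map_zero (((Ext R (ModuleCat.{u} R) i).map
    (powQuotMap J (leOfHom f.unop.unop)).op).app N).hom

theorem map_derivedExtToLocalCohomology {i : ℕ} {N N' : ModuleCat.{u} R} (f : N ⟶ N') (t : ℕ)
    (e : ((Ext R (ModuleCat.{u} R) i).obj (op (powQuot J t))).obj N) :
    ((localCohomology J i).map f).hom (derivedExtToLocalCohomology J i N t e) =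
      derivedExtToLocalCohomology J i N' t
        ((((Ext R (ModuleCat.{u} R) i).obj (op (powQuot J t))).map f).hom e) := by
  have := (colimit.ι (localCohomology.diagram (localCohomology.idealPowersDiagram J) i)
    (op (op t))).naturality f
  exact (congrArg (fun φ => φ.hom e) this).symm

variable (J) in
/-- The comparison map from the direct limit of modules `Ext` to local cohomology. -/
def limExtToLocalCohomology (i : ℕ) (N : ModuleCat.{u} R) :
    limExt J (i + 1) N →ₗ[R] (localCohomology J (i + 1)).obj N :=
  Module.DirectLimit.lift _ _ _ _
    (fun t => derivedExtToLocalCohomology J (i + 1) N t ∘ₗ extEquivDerivedExt _ N i) (by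
      intro s t h e
      change derivedExtToLocalCohomology J (i + 1) N t (extToDerivedExt
        ((Abelian.Ext.mk₀ (powQuotMap J h)).comp e (zero_add (i + 1)))) =
        derivedExtToLocalCohomology J (i + 1) N s (extToDerivedExt e)
      rw [← map_op_extToDerivedExt, derivedExtToLocalCohomology_transition])

theorem limExtToLocalCohomology_toLimExt {i : ℕ} {N : ModuleCat.{u} R} (t : ℕ)
    (e : Abelian.Ext.{u} (powQuot J t) N (i + 1)) :
    limExtToLocalCohomology J i N (toLimExt J (i + 1) N t e) =
      derivedExtToLocalCohomology J (i + 1) N t (extToDerivedExt e) :=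
  Module.DirectLimit.lift_of _ _ _

theorem limExtToLocalCohomology_bijective (i : ℕ) (N : ModuleCat.{u} R) :
    Function.Bijective (limExtToLocalCohomology J i N) := by
  constructor
  · rw [← LinearMap.ker_eq_bot, LinearMap.ker_eq_bot']
    intro x hx
    obtain ⟨s, e, rfl⟩ := exists_toLimExt x
    rw [limExtToLocalCohomology_toLimExt] at hx
    obtain ⟨t, h, ht⟩ := derivedExtToLocalCohomology_eq_zero hx
    rw [map_op_extToDerivedExt] at ht
    rw [← toLimExt_transition h]
    have : (Abelian.Ext.mk₀ (powQuotMap J h)).comp e (zero_add (i + 1)) = 0 :=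
      extToDerivedExt_bijective.injective
        (ht.trans (map_zero (extEquivDerivedExt (powQuot J t) N i)).symm)
    rw [this, map_zero]
  · intro x
    obtain ⟨t, e, rfl⟩ := exists_derivedExtToLocalCohomology x
    obtain ⟨e, rfl⟩ := extToDerivedExt_bijective.surjective e
    exact ⟨toLimExt J (i + 1) N t e, limExtToLocalCohomology_toLimExt t e⟩

theorem map_limExtToLocalCohomology {i : ℕ} {N N' : ModuleCat.{u} R} (f : N ⟶ N')
    (x : limExt J (i + 1) N) :
    ((localCohomology J (i + 1)).map f).hom (limExtToLocalCohomology J i N x) =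
      limExtToLocalCohomology J i N' (limExtMap (i + 1) f x) := by
  obtain ⟨t, e, rfl⟩ := exists_toLimExt x
  rw [limExtToLocalCohomology_toLimExt, map_derivedExtToLocalCohomology, map_extToDerivedExt,
    limExtMap_toLimExt, limExtToLocalCohomology_toLimExt]

end LimExt
end PerfectoidTest
end

noncomputable section

namespace PerfectoidTest

open Limits Opposite

/-! ### Regular sequences: vanishing below the length, and the torsion in degree equal to the
length. -/

section Depth

open Pointwise

variable {R : Type u} [CommRing R] {J : Ideal R}

/-- The connecting map of the long exact sequence for `limExt`. -/
def limExtDelta {S : ShortComplex (ModuleCat.{u} R)} (hS : S.ShortExact) (i : ℕ) :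
    limExt J i S.X₃ →ₗ[R] limExt J (i + 1) S.X₁ :=
  Module.DirectLimit.map
    (fun t => hS.extClass.postcompOfLinear R (powQuot J t) (rfl : i + 1 = i + 1)) (by
      intro s t h
      ext e
      exact Abelian.Ext.comp_assoc _ _ _ (zero_add i) rfl (by omega))

theorem limExtDelta_toLimExt {S : ShortComplex (ModuleCat.{u} R)} (hS : S.ShortExact) {i : ℕ}
    (t : ℕ) (e : Abelian.Ext.{u} (powQuot J t) S.X₃ i) :
    limExtDelta hS i (toLimExt J i S.X₃ t e) = toLimExt J (i + 1) S.X₁ t (e.comp hS.extClass rfl) :=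
  Module.DirectLimit.map_apply_of _ _ _

theorem exists_limExtDelta_eq {S : ShortComplex (ModuleCat.{u} R)} (hS : S.ShortExact) {i : ℕ}
    (x : limExt J (i + 1) S.X₁) (hx : limExtMap (i + 1) S.f x = 0) :
    ∃ y, limExtDelta hS i y = x := by
  obtain ⟨s, e, rfl⟩ := exists_toLimExt x
  rw [limExtMap_toLimExt] at hx
  obtain ⟨t, h, ht⟩ := toLimExt_eq_zero hx
  rw [← Abelian.Ext.comp_assoc_of_third_deg_zero] at ht
  obtain ⟨y, hy⟩ := Abelian.Ext.covariant_sequence_exact₁ _ hS _ ht rfl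
  exact ⟨toLimExt J i S.X₃ t y, by rw [limExtDelta_toLimExt, hy, toLimExt_transition]⟩

theorem limExtMap_limExtDelta {S : ShortComplex (ModuleCat.{u} R)} (hS : S.ShortExact) {i : ℕ}
    (y : limExt J i S.X₃) : limExtMap (i + 1) S.f (limExtDelta hS i y) = 0 := by
  obtain ⟨s, e, rfl⟩ := exists_toLimExt y
  rw [limExtDelta_toLimExt, limExtMap_toLimExt, Abelian.Ext.comp_assoc_of_third_deg_zero,
    hS.extClass_comp, Abelian.Ext.comp_zero, map_zero]

theorem exists_limExtMap_eq {S : ShortComplex (ModuleCat.{u} R)} (hS : S.ShortExact) {i : ℕ}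
    (y : limExt J i S.X₃) (hy : limExtDelta hS i y = 0) : ∃ z, limExtMap i S.g z = y := by
  obtain ⟨s, e, rfl⟩ := exists_toLimExt y
  rw [limExtDelta_toLimExt] at hy
  obtain ⟨t, h, ht⟩ := toLimExt_eq_zero hy
  rw [← Abelian.Ext.comp_assoc _ _ _ (zero_add i) rfl (by omega)] at ht
  obtain ⟨y, hy⟩ := Abelian.Ext.covariant_sequence_exact₃ _ hS _ rfl ht
  exact ⟨toLimExt J i S.X₂ t y, by rw [limExtMap_toLimExt, hy, toLimExt_transition]⟩

theorem limExtMap_smul_id {i : ℕ} {N : ModuleCat.{u} R} (r : R) (x : limExt J i N) :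
    limExtMap i (r • 𝟙 N) x = r • x := by
  obtain ⟨s, e, rfl⟩ := exists_toLimExt x
  rw [limExtMap_toLimExt, ← map_smul]
  congr 1
  simp [Abelian.Ext.mk₀_smul]

theorem limExt_zero_smul_injective {N : ModuleCat.{u} R} {r : R} (hr : IsSMulRegular N r)
    {x : limExt J 0 N} (hx : r • x = 0) : x = 0 := by
  have : Mono (r • 𝟙 N) := hr.smulShortComplex_shortExact.mono_f
  obtain ⟨s, e, rfl⟩ := exists_toLimExt x
  rw [← map_smul] at hx
  obtain ⟨t, h, ht⟩ := toLimExt_eq_zero hx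
  rw [← toLimExt_transition h]
  have : (Abelian.Ext.mk₀ (powQuotMap J h)).comp e (zero_add 0) = 0 := by
    apply Abelian.Ext.postcomp_mk₀_injective_of_mono _ (r • 𝟙 N)
    rw [map_zero, ← ht]
    simp [Abelian.Ext.mk₀_smul]
  rw [this, map_zero]

/-- Multiplication by the first element `r` is injective: in degree 0 by left exactness of Hom, in
higher degree because its kernel comes from the limit for N/rN one degree lower, which vanishes by
induction. But `r ∈ J`, so each element is killed by a power of `r`. -/
theorem limExt_subsingleton {rs : List R} (hJ : ∀ r ∈ rs, r ∈ J) (N : Type u) [AddCommGroup N]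
    [Module R N] (h : RingTheory.Sequence.IsWeaklyRegular N rs) {i : ℕ} (hi : i < rs.length) :
    Subsingleton (limExt J i (ModuleCat.of R N)) := by
  induction rs generalizing N i with
  | nil => simp at hi
  | cons r rs ih =>
    rw [RingTheory.Sequence.isWeaklyRegular_cons_iff] at h
    have hinj : ∀ x : limExt J i (ModuleCat.of R N), r • x = 0 → x = 0 := by
      intro x hx
      cases i with
      | zero => exact limExt_zero_smul_injective h.1 hx
      | succ i =>
        rw [← limExtMap_smul_id] at hx
        have hS := IsSMulRegular.smulShortComplex_shortExact (M := ModuleCat.of R N) h.1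
        obtain ⟨y, rfl⟩ := exists_limExtDelta_eq hS x hx
        have := ih (fun r hr => hJ r (List.mem_cons_of_mem _ hr)) (QuotSMulTop r N) h.2
          (i := i) (by simpa using hi)
        have hy : y = 0 := this.elim y 0
        rw [hy, map_zero]
        rfl
    have hpow : ∀ (t : ℕ) (x : limExt J i (ModuleCat.of R N)), r ^ t • x = 0 → x = 0 := by
      intro t
      induction t with
      | zero => intro x hx; simpa using hx
      | succ t iht =>
        intro x hx
        exact hinj x (iht _ (by rwa [smul_smul, ← pow_succ]))
    refine subsingleton_of_forall_eq 0 fun x => ?_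
    obtain ⟨t, ht⟩ := exists_pow_smul_limExt_eq_zero x
    exact hpow t x (ht _ (Ideal.pow_mem_pow (hJ r List.mem_cons_self) t))

/-- The homomorphism `R / J ^ t → N` with `1 ↦ n`, for a module `N` killed by `J ^ t`. -/
def powQuotHom (N : Type u) [AddCommGroup N] [Module R N] {t : ℕ}
    (h : ∀ a ∈ J ^ t, ∀ n : N, a • n = 0) (n : N) : powQuot J t ⟶ ModuleCat.of R N :=
  ModuleCat.ofHom (Submodule.liftQ (J ^ t) (LinearMap.toSpanSingleton R N n)
    fun a ha => h a ha n)

theorem powQuotMap_powQuotHom (N : Type u) [AddCommGroup N] [Module R N] {s t : ℕ} (hst : s ≤ t)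
    (h : ∀ a ∈ J ^ s, ∀ n : N, a • n = 0) (n : N) :
    powQuotMap J hst ≫ powQuotHom N h n =
      powQuotHom N (fun a ha => h a (Ideal.pow_le_pow_right hst ha)) n := by
  ext (x : R ⧸ J ^ t)
  obtain ⟨x, rfl⟩ := Ideal.Quotient.mk_surjective x
  rfl

theorem powQuotHom_one (N : Type u) [AddCommGroup N] [Module R N] {t : ℕ}
    (h : ∀ a ∈ J ^ t, ∀ n : N, a • n = 0) (n : N) :
    (powQuotHom N h n).hom (Ideal.Quotient.mk (J ^ t) 1) = n :=
  one_smul R n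

theorem powQuotHom_apply_one (N : Type u) [AddCommGroup N] [Module R N] {t : ℕ}
    (h : ∀ a ∈ J ^ t, ∀ n : N, a • n = 0) (ψ : powQuot J t ⟶ ModuleCat.of R N) :
    powQuotHom N h (ψ.hom (Ideal.Quotient.mk (J ^ t) 1)) = ψ := by
  ext (x : R ⧸ J ^ t)
  obtain ⟨x, rfl⟩ := Ideal.Quotient.mk_surjective x
  change x • ψ.hom (Ideal.Quotient.mk (J ^ t) 1) = _
  refine (ψ.hom.map_smul x _).symm.trans (congrArg ψ.hom ?_)
  change Ideal.Quotient.mk (J ^ t) (x * 1) = _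
  rw [mul_one]

/-- The identification of a `J`-power torsion module with its direct limit `limExt J 0`. -/
def toLimExtZero (N : Type u) [AddCommGroup N] [Module R N] {t : ℕ}
    (h : ∀ a ∈ J ^ t, ∀ n : N, a • n = 0) : N →ₗ[R] limExt J 0 (ModuleCat.of R N) where
  toFun n := toLimExt J 0 _ t (Abelian.Ext.mk₀ (powQuotHom N h n))
  map_add' n n' := by
    rw [← map_add, ← Abelian.Ext.mk₀_add]
    congr 2
    ext (x : R ⧸ J ^ t)
    obtain ⟨x, rfl⟩ := Ideal.Quotient.mk_surjective x
    exact smul_add x n n'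
  map_smul' r n := by
    rw [RingHom.id_apply, ← map_smul, ← Abelian.Ext.mk₀_smul]
    congr 2
    ext (x : R ⧸ J ^ t)
    obtain ⟨x, rfl⟩ := Ideal.Quotient.mk_surjective x
    exact smul_comm x r n

theorem toLimExtZero_bijective (N : Type u) [AddCommGroup N] [Module R N] {s : ℕ}
    (hs : ∀ a ∈ J ^ s, ∀ n : N, a • n = 0) : Function.Bijective (toLimExtZero N hs) := by
  constructor
  · rw [← LinearMap.ker_eq_bot, LinearMap.ker_eq_bot']
    intro n hn
    obtain ⟨t, h, ht⟩ := toLimExt_eq_zero hn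
    rw [Abelian.Ext.mk₀_comp_mk₀, powQuotMap_powQuotHom, ← Abelian.Ext.mk₀_zero] at ht
    have := (Abelian.Ext.mk₀_bijective _ _).injective ht
    rw [← powQuotHom_one N (fun a ha => hs a (Ideal.pow_le_pow_right h ha)) n, this]
    rfl
  · intro x
    obtain ⟨t, e, rfl⟩ := exists_toLimExt x
    -- At a level at least `s` the ideal power kills `N`, so homomorphisms from the quotient of `R`
    -- correspond to elements of `N`.
    rw [← toLimExt_transition (le_max_left t s)]
    obtain ⟨ψ, hψ⟩ := (Abelian.Ext.mk₀_bijective _ _).surjective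
      ((Abelian.Ext.mk₀ (powQuotMap J (le_max_left t s))).comp e (zero_add 0))
    refine ⟨ψ.hom (Ideal.Quotient.mk _ 1), ?_⟩
    rw [← hψ]
    conv_rhs => rw [← powQuotHom_apply_one N
      (fun a ha => hs a (Ideal.pow_le_pow_right (le_max_right t s) ha)) ψ]
    rw [← powQuotMap_powQuotHom N (le_max_right t s) hs, ← Abelian.Ext.mk₀_comp_mk₀,
      toLimExt_transition]
    rfl

/-- Induction along the sequence. The connecting map from N/rN is injective, since the limit for N
vanishes one degree lower, and its image is the `r`-torsion; so it matches the torsion by the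
remaining elements with the torsion by all of them. The induction ends in degree 0 at a module
killed by J^s, whose limit is itself. -/
theorem nonempty_torsionBySet_limExt_equiv {rs : List R} (hJ : ∀ r ∈ rs, r ∈ J) (N : Type u)
    [AddCommGroup N] [Module R N] (h : RingTheory.Sequence.IsWeaklyRegular N rs) {s : ℕ}
    (hs : ∀ a ∈ J ^ s, ∀ y : N ⧸ (Ideal.ofList rs • ⊤ : Submodule R N), a • y = 0)
    {n : ℕ} (hn : n = rs.length) :
    Nonempty ((N ⧸ (Ideal.ofList rs • ⊤ : Submodule R N)) ≃ₗ[R]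
      Submodule.torsionBySet R (limExt J n (ModuleCat.of R N)) {r | r ∈ rs}) := by
  induction rs generalizing N n with
  | nil =>
    obtain rfl : n = 0 := hn
    have h0 : (Ideal.ofList ([] : List R) • ⊤ : Submodule R N) = ⊥ := by simp
    let e := Submodule.quotEquivOfEqBot _ h0
    have h1 : Submodule.torsionBySet R (limExt J 0 (ModuleCat.of R N)) {r | r ∈ ([] : List R)} =
        ⊤ := by
      rw [eq_top_iff]
      rintro x -
      rw [Submodule.mem_torsionBySet_iff]
      rintro ⟨a, ha⟩
      simp at ha
    have hs' : ∀ a ∈ J ^ s, ∀ n : N, a • n = 0 := by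
      intro a ha n
      have := congrArg e (hs a ha (e.symm n))
      simpa using this
    exact ⟨e ≪≫ₗ LinearEquiv.ofBijective _ (toLimExtZero_bijective N hs') ≪≫ₗ
      (LinearEquiv.ofTop _ h1).symm⟩
  | cons r rs ih =>
    obtain rfl : n = rs.length + 1 := hn
    have h' := (RingTheory.Sequence.isWeaklyRegular_cons_iff N r rs).mp h
    have hJ' : ∀ r ∈ rs, r ∈ J := fun r hr => hJ r (List.mem_cons_of_mem _ hr)
    let e := Submodule.quotOfListConsSMulTopEquivQuotSMulTopInner N r rs
    obtain ⟨e'⟩ := ih hJ' (QuotSMulTop r N) h'.2 (by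
      intro a ha y
      have := congrArg e (hs a ha (e.symm y))
      simpa using this) rfl
    have hS := IsSMulRegular.smulShortComplex_shortExact (M := ModuleCat.of R N) h'.1
    let δ : limExt J rs.length (ModuleCat.of R (QuotSMulTop r N)) →ₗ[R]
      limExt J (rs.length + 1) (ModuleCat.of R N) := limExtDelta hS rs.length
    have hδinj : ∀ y, δ y = 0 → y = 0 := by
      intro y hy
      obtain ⟨z, rfl⟩ := exists_limExtMap_eq hS y hy
      have := limExt_subsingleton hJ N h (i := rs.length) (by simp)
      have hz : z = 0 := this.elim z 0
      rw [hz, map_zero]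
      rfl
    have hδr : ∀ y, r • δ y = 0 := fun y => by
      rw [← limExtMap_smul_id]
      exact limExtMap_limExtDelta hS y
    have hmem : ∀ y, y ∈ Submodule.torsionBySet R
        (limExt J rs.length (ModuleCat.of R (QuotSMulTop r N))) {r | r ∈ rs} ↔
        δ y ∈ Submodule.torsionBySet R (limExt J (rs.length + 1) (ModuleCat.of R N))
          {a | a ∈ r :: rs} := by
      intro y
      rw [Submodule.mem_torsionBySet_iff, Submodule.mem_torsionBySet_iff]
      constructor
      · rintro hy ⟨a, ha⟩
        rcases List.mem_cons.mp ha with rfl | ha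
        · exact hδr y
        · change a • δ y = 0
          rw [← map_smul]
          exact (congrArg δ (hy ⟨a, ha⟩)).trans (map_zero δ)
      · rintro hy ⟨a, ha⟩
        apply hδinj
        rw [map_smul]
        exact hy ⟨a, List.mem_cons_of_mem _ ha⟩
    let φ := δ.restrict fun y hy => (hmem y).mp hy
    have hφ : Function.Bijective φ := by
      constructor
      · intro y y' h
        apply Subtype.ext
        rw [← sub_eq_zero]
        apply hδinj
        rw [map_sub, sub_eq_zero]
        exact congrArg Subtype.val h
      · rintro ⟨x, hx⟩
        have hx' := hx
        rw [Submodule.mem_torsionBySet_iff] at hx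
        obtain ⟨y, hy⟩ := exists_limExtDelta_eq hS x
          ((limExtMap_smul_id r x).trans (hx ⟨r, List.mem_cons_self⟩))
        have hy' : δ y = x := hy
        exact ⟨⟨y, (hmem y).mpr (hy'.symm ▸ hx')⟩, Subtype.ext hy'⟩
    exact ⟨e ≪≫ₗ e' ≪≫ₗ LinearEquiv.ofBijective φ hφ⟩

end Depth
end PerfectoidTest
end

noncomputable section

namespace PerfectoidTest

/-! ### Regular local rings: domains whose maximal ideal is generated by a regular sequence. -/

section Regular

open IsLocalRing Pointwise RingTheory.Sequence

/-- Modulo `x` the dimension drops by at most one, while the generators left over number at most one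
less than the embedding dimension. As embedding dimension bounds dimension, equality holds
throughout. -/
theorem isRegularLocalRing_quotient {R : Type u} [CommRing R] [IsRegularLocalRing R]
    {s : Finset R} {x : R} (hs : Ideal.span (insert x (s : Set R)) = maximalIdeal R)
    (hcard : s.card + 1 ≤ (maximalIdeal R).spanFinrank) :
    ∃ _ : IsRegularLocalRing (R ⧸ Ideal.span {x}),
      (maximalIdeal (R ⧸ Ideal.span {x})).spanFinrank + 1 = (maximalIdeal R).spanFinrank := by
  classical
  have hx : x ∈ maximalIdeal R := by
    rw [← hs]; exact Ideal.subset_span (Set.mem_insert _ _)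
  have : Nontrivial (R ⧸ Ideal.span {x}) := Ideal.Quotient.nontrivial_iff.mpr
    (ne_top_of_le_ne_top (maximalIdeal.isMaximal R).ne_top
      ((Ideal.span_singleton_le_iff_mem _).mpr hx))
  have : IsLocalRing (R ⧸ Ideal.span {x}) :=
    .of_surjective' (Ideal.Quotient.mk _) Ideal.Quotient.mk_surjective
  have h1 : maximalIdeal (R ⧸ Ideal.span {x}) =
      Ideal.span (Ideal.Quotient.mk (Ideal.span {x}) '' s) := by
    rw [← map_maximalIdeal_of_surjective (Ideal.Quotient.mk (Ideal.span {x}))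
      Ideal.Quotient.mk_surjective, ← hs, Ideal.map_span, Set.image_insert_eq,
      Ideal.Quotient.eq_zero_iff_mem.mpr (Ideal.mem_span_singleton_self x), Ideal.span_insert_zero]
  have h2 : (maximalIdeal (R ⧸ Ideal.span {x})).spanFinrank ≤ s.card := by
    rw [h1]
    refine (Submodule.spanFinrank_span_le_ncard_of_finite (s.finite_toSet.image _)).trans ?_
    refine (Set.ncard_image_le s.finite_toSet).trans ?_
    simp
  have h3 := Ideal.height_le_ringKrullDim_quotient_add_one hx
  rw [maximalIdeal_height_eq_ringKrullDim, ← IsRegularLocalRing.spanFinrank_maximalIdeal] at h3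
  have h4 := ringKrullDim_le_spanFinrank_maximalIdeal (R ⧸ Ideal.span {x})
  have h5 : ((maximalIdeal R).spanFinrank : WithBot ℕ∞) ≤
      (((maximalIdeal (R ⧸ Ideal.span {x})).spanFinrank + 1 : ℕ) : WithBot ℕ∞) := by
    push_cast
    exact h3.trans (by gcongr)
  have h6 : (maximalIdeal R).spanFinrank ≤
      (maximalIdeal (R ⧸ Ideal.span {x})).spanFinrank + 1 := by exact_mod_cast h5
  have h7 : (maximalIdeal (R ⧸ Ideal.span {x})).spanFinrank + 1 =
    (maximalIdeal R).spanFinrank := by omega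
  refine ⟨IsRegularLocalRing.of_spanFinrank_maximalIdeal_le _ ?_, h7⟩
  rw [← h7] at h3
  push_cast at h3
  exact (ENat.WithBot.add_le_add_one_right_iff).mp h3

/-- If all coefficients of `x` in the generators were in 𝔪, then x ∈ 𝔪². A generator with unit
coefficient can be exchanged for `x`. -/
theorem exists_unit_coeff {R : Type u} [CommRing R] [IsLocalRing R] {s : Finset R}
    (hs : Ideal.span (s : Set R) = maximalIdeal R) {x : R} (hx : x ∈ maximalIdeal R)
    (hx2 : x ∉ maximalIdeal R ^ 2) [DecidableEq R] :
    ∃ y ∈ s, Ideal.span (insert x ((s.erase y : Finset R) : Set R)) = maximalIdeal R := by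
  rw [← hs] at hx
  obtain ⟨a, -, ha⟩ := Submodule.mem_span_finset.mp hx
  simp only [smul_eq_mul] at ha
  have : ∃ y ∈ s, IsUnit (a y) := by
    by_contra! h
    apply hx2
    rw [← ha, pow_two]
    refine Ideal.sum_mem _ fun y hy => ?_
    refine Ideal.mul_mem_mul ((mem_maximalIdeal _).mpr (h y hy)) ?_
    rw [← hs]
    exact Ideal.subset_span hy
  obtain ⟨y, hys, hy⟩ := this
  refine ⟨y, hys, le_antisymm ?_ ?_⟩
  · rw [Ideal.span_le]
    rintro z (rfl | hz)
    · rw [← hs, ← ha]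
      exact Ideal.sum_mem _ fun y hy => Ideal.mul_mem_left _ _ (Ideal.subset_span hy)
    · rw [← hs]
      exact Ideal.subset_span (Finset.mem_of_mem_erase hz)
  · rw [← hs, Ideal.span_le]
    have key : ∀ z ∈ s, z ≠ y → z ∈ Ideal.span (insert x ((s.erase y : Finset R) : Set R)) :=
      fun z hz hzy => Ideal.subset_span (Set.mem_insert_of_mem _ (Finset.mem_coe.mpr
        (Finset.mem_erase.mpr ⟨hzy, hz⟩)))
    intro z hz
    by_cases hzy : z = y
    · subst hzy
      rw [SetLike.mem_coe, ← Ideal.unit_mul_mem_iff_mem _ hy]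
      have h1 : a z * z = x - ∑ i ∈ s.erase z, a i * i := by
        rw [eq_sub_iff_add_eq, Finset.add_sum_erase _ (fun i => a i * i) hz, ha]
      rw [h1]
      refine Ideal.sub_mem _ (Ideal.subset_span (Set.mem_insert _ _)) (Ideal.sum_mem _ ?_)
      intro i hi
      exact Ideal.mul_mem_left _ _ (key i (Finset.mem_erase.mp hi).2 (Finset.mem_erase.mp hi).1)
    · exact key z hz hzy

/-- Induction on the embedding dimension. For x ∈ 𝔪 outside 𝔪² and all minimal primes, R/(x) is
regular of smaller dimension, so (x) is prime and contains a minimal prime P. From x ∉ P follows P =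
xP, and Nakayama gives P = 0. -/
theorem isDomain_of_isRegularLocalRing {R : Type u} [CommRing R] [IsRegularLocalRing R] :
    IsDomain R := by
  classical
  obtain ⟨n, hn⟩ : ∃ n, (maximalIdeal R).spanFinrank = n := ⟨_, rfl⟩
  induction n generalizing R with
  | zero =>
    rw [Submodule.spanFinrank_eq_zero_iff_eq_bot (IsNoetherian.noetherian _)] at hn
    exact (isField_iff_maximalIdeal_eq.mpr hn).isDomain
  | succ n ih =>
    have hne : maximalIdeal R ≠ ⊥ := by
      intro h
      rw [h, Submodule.spanFinrank_bot] at hn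
      omega
    have hfg : (maximalIdeal R).FG := IsNoetherian.noetherian _
    -- Prime avoidance tolerates members that need not be prime; 𝔪² is the one needed here.
    have havoid : ¬ ((maximalIdeal R : Set R) ⊆
        ⋃ I ∈ insert (maximalIdeal R ^ 2) (minimalPrimes R), (I : Set R)) := by
      refine mt (Ideal.subset_union_prime_finite (f := fun I : Ideal R => I)
        ((minimalPrimes.finite_of_isNoetherianRing R).insert _)
        (maximalIdeal R ^ 2) (maximalIdeal R ^ 2) ?_).mp ?_
      rotate_left
      · rintro ⟨I, hI | hI, hle⟩
        · subst hI
          apply hne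
          apply Submodule.eq_bot_of_le_smul_of_le_jacobson_bot (maximalIdeal R) _ hfg
          · rw [smul_eq_mul, ← pow_two]; exact hle
          · exact maximalIdeal_le_jacobson _
        · have : maximalIdeal R = I :=
            (maximalIdeal.isMaximal R).eq_of_le hI.1.1.ne_top hle
          have h0 : (maximalIdeal R).height = 0 := by
            rw [this]
            have := hI.1.1
            exact Ideal.height_eq_zero_iff.mpr hI
          have h1 := maximalIdeal_height_eq_ringKrullDim (R := R)
          rw [h0, ← IsRegularLocalRing.spanFinrank_maximalIdeal, hn] at h1
          norm_cast at h1
      · rintro I (hI | hI) h _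
        · exact absurd hI h
        · exact hI.1.1
    rw [Set.not_subset] at havoid
    obtain ⟨x, hx, hx'⟩ := havoid
    simp only [Set.mem_iUnion, not_exists, Set.mem_insert_iff] at hx'
    obtain ⟨s, hscard, hs⟩ := Submodule.FG.exists_span_finset_card_eq_spanFinrank hfg
    obtain ⟨y, hy, hspan⟩ := exists_unit_coeff hs hx (hx' _ (Or.inl rfl))
    obtain ⟨hreg, hrank⟩ := isRegularLocalRing_quotient hspan (by
      rw [Finset.card_erase_add_one hy, hscard])
    have hdom := ih (R := R ⧸ Ideal.span {x}) (by omega)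
    have hprime : (Ideal.span {x}).IsPrime := (Ideal.Quotient.isDomain_iff_prime _).mp hdom
    obtain ⟨P, hP, hPx⟩ := Ideal.exists_minimalPrimes_le (bot_le : ⊥ ≤ Ideal.span {x})
    have hPprime : P.IsPrime := hP.1.1
    have hxP : x ∉ P := hx' P (Or.inr hP)
    have hbot : P = ⊥ := by
      apply Submodule.eq_bot_of_le_smul_of_le_jacobson_bot (maximalIdeal R) _
        (IsNoetherian.noetherian _) _ (maximalIdeal_le_jacobson _)
      intro y hy
      obtain ⟨z, rfl⟩ := Ideal.mem_span_singleton'.mp (hPx hy)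
      rw [mul_comm, smul_eq_mul]
      exact Ideal.mul_mem_mul hx ((hPprime.mem_or_mem hy).resolve_right hxP)
    rw [hbot] at hPprime
    exact IsDomain.of_bot_isPrime R

/-- A nonzero member `x` of a minimal generating set is a nonzerodivisor, as `R` is a domain, and
the quotient by `x` is again regular, so a sequence there lifts. -/
theorem exists_isWeaklyRegular_of_isRegularLocalRing {R : Type u} [CommRing R]
    [IsRegularLocalRing R] :
    ∃ rs : List R, rs.length = (maximalIdeal R).spanFinrank ∧ Ideal.ofList rs = maximalIdeal R ∧
      IsWeaklyRegular R rs := by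
  classical
  obtain ⟨n, hn⟩ : ∃ n, (maximalIdeal R).spanFinrank = n := ⟨_, rfl⟩
  induction n generalizing R with
  | zero =>
    refine ⟨[], hn.symm, ?_, .nil _ _⟩
    rw [Submodule.spanFinrank_eq_zero_iff_eq_bot (IsNoetherian.noetherian _)] at hn
    rw [hn, Ideal.ofList_nil]
  | succ n ih =>
    have := isDomain_of_isRegularLocalRing (R := R)
    have hfg : (maximalIdeal R).FG := IsNoetherian.noetherian _
    obtain ⟨s, hscard, hs⟩ := Submodule.FG.exists_span_finset_card_eq_spanFinrank hfg
    have hne : maximalIdeal R ≠ ⊥ := by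
      intro h
      rw [h, Submodule.spanFinrank_bot] at hn
      omega
    obtain ⟨x, hxs, hx0⟩ : ∃ x ∈ s, x ≠ 0 := by
      by_contra! h
      apply hne
      rw [← hs, Submodule.span_eq_bot]
      exact h
    have hspan : Ideal.span (insert x ((s.erase x : Finset R) : Set R)) = maximalIdeal R := by
      rw [← Finset.coe_insert, Finset.insert_erase hxs]
      exact hs
    obtain ⟨hreg, hrank⟩ := isRegularLocalRing_quotient hspan (by
      rw [Finset.card_erase_add_one hxs, hscard])
    obtain ⟨rs', hlen, hmax, hwr⟩ := ih (R := R ⧸ Ideal.span {x}) (by omega)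
    obtain ⟨rs, rfl⟩ : ∃ rs : List R, rs.map (Ideal.Quotient.mk (Ideal.span {x})) = rs' :=
      Set.mem_range.mp (by rw [Ideal.Quotient.mk_surjective.list_map.range_eq]; trivial)
    refine ⟨x :: rs, ?_, ?_, ?_⟩
    · rw [List.length_map] at hlen
      rw [List.length_cons, hlen, hrank]
    · have h1 := congrArg (Ideal.comap (Ideal.Quotient.mk (Ideal.span {x}))) hmax
      rw [← Ideal.map_ofList, Ideal.comap_map_of_surjective' _ Ideal.Quotient.mk_surjective,
        Ideal.mk_ker] at h1
      rw [Ideal.ofList_cons, sup_comm, h1]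
      have := IsLocalHom.of_surjective (Ideal.Quotient.mk (Ideal.span {x}))
        Ideal.Quotient.mk_surjective
      exact maximalIdeal_comap _
    · rw [isWeaklyRegular_cons_iff]
      refine ⟨fun a b h => mul_left_cancel₀ hx0 h, ?_⟩
      have h1 : IsWeaklyRegular (R ⧸ Ideal.span {x}) rs :=
        (isWeaklyRegular_map_algebraMap_iff (R ⧸ Ideal.span {x}) _ rs).mp hwr
      refine (LinearEquiv.isWeaklyRegular_congr
        (Submodule.quotEquivOfEq _ _ ?_) rs).mp h1
      rw [← Submodule.ideal_span_singleton_smul]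
      simp

/-- Weakly regular sequences are closed under extensions of modules. -/
theorem isWeaklyRegular_of_exact {R : Type u} [CommRing R] {rs : List R} {M M' M'' : Type v}
    [AddCommGroup M] [Module R M] [AddCommGroup M'] [Module R M'] [AddCommGroup M'']
    [Module R M''] (f : M' →ₗ[R] M) (g : M →ₗ[R] M'') (hf : Function.Injective f)
    (hfg : Function.Exact f g) (hg : Function.Surjective g) (h' : IsWeaklyRegular M' rs)
    (h'' : IsWeaklyRegular M'' rs) : IsWeaklyRegular M rs := by
  induction rs generalizing M M' M'' with
  | nil => exact .nil _ _
  | cons r rs ih =>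
    rw [isWeaklyRegular_cons_iff] at h' h'' ⊢
    have hreg : IsSMulRegular M r := by
      rw [isSMulRegular_iff_right_eq_zero_of_smul]
      intro x hx
      have h1 : g x = 0 := h''.1.right_eq_zero_of_smul (by rw [← map_smul, hx, map_zero])
      obtain ⟨y, rfl⟩ := (hfg x).mp h1
      have h2 : y = 0 := h'.1.right_eq_zero_of_smul (hf (by rw [map_smul, hx, map_zero]))
      rw [h2, map_zero]
    refine ⟨hreg, ih (QuotSMulTop.map r f) (QuotSMulTop.map r g) ?_
      (QuotSMulTop.map_exact r hfg hg) (QuotSMulTop.map_surjective r hg) h'.2 h''.2⟩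
    -- M'/rM' → M/rM stays injective because `r` is regular on M'': if f(y) = rx then r g(x) = 0, so
    -- x comes from M'.
    rw [← LinearMap.ker_eq_bot, LinearMap.ker_eq_bot']
    intro y hy
    obtain ⟨y, rfl⟩ := Submodule.Quotient.mk_surjective _ y
    have h1 : f y ∈ r • (⊤ : Submodule R M) := (Submodule.Quotient.mk_eq_zero _).mp hy
    obtain ⟨x, -, hx⟩ := (Submodule.mem_smul_pointwise_iff_exists _ _ _).mp h1
    have h2 : g x = 0 := h''.1.right_eq_zero_of_smul (by
      rw [← map_smul, hx]; exact (hfg _).mpr ⟨y, rfl⟩)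
    obtain ⟨z, rfl⟩ := (hfg x).mp h2
    refine (Submodule.Quotient.mk_eq_zero _).mpr ?_
    rw [Submodule.mem_smul_pointwise_iff_exists]
    exact ⟨z, trivial, hf (by rw [map_smul, hx])⟩

/-- Induction with the exact sequence 0 → M/r^{t+1}M → M/r^{t+2}M → M/rM → 0, whose first map is
multiplication by `r`. -/
theorem isWeaklyRegular_quotSMulTop_pow {R : Type u} [CommRing R] {r : R} {rs : List R}
    {M : Type v} [AddCommGroup M] [Module R M] (hr : IsSMulRegular M r)
    (h : IsWeaklyRegular (QuotSMulTop r M) rs) (t : ℕ) :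
    IsWeaklyRegular (QuotSMulTop (r ^ (t + 1)) M) rs := by
  induction t with
  | zero => rwa [zero_add, pow_one]
  | succ t ih =>
    have hle : ∀ x ∈ r ^ (t + 1) • (⊤ : Submodule R M),
        LinearMap.lsmul R M r x ∈ r ^ (t + 1 + 1) • (⊤ : Submodule R M) := by
      intro x hx
      obtain ⟨y, -, rfl⟩ := (Submodule.mem_smul_pointwise_iff_exists _ _ _).mp hx
      refine (Submodule.mem_smul_pointwise_iff_exists _ _ _).mpr ⟨y, trivial, ?_⟩
      rw [LinearMap.lsmul_apply, smul_smul, ← pow_succ']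
    have hle' : r ^ (t + 1 + 1) • (⊤ : Submodule R M) ≤ r • (⊤ : Submodule R M) := by
      intro x hx
      obtain ⟨y, -, rfl⟩ := (Submodule.mem_smul_pointwise_iff_exists _ _ _).mp hx
      refine (Submodule.mem_smul_pointwise_iff_exists _ _ _).mpr ⟨r ^ (t + 1) • y, trivial, ?_⟩
      rw [smul_smul, ← pow_succ']
    refine isWeaklyRegular_of_exact
      (Submodule.mapQ (r ^ (t + 1) • (⊤ : Submodule R M)) (r ^ (t + 1 + 1) • (⊤ : Submodule R M))
        (LinearMap.lsmul R M r) hle)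
      (Submodule.factor hle') ?_ ?_ (Submodule.factor_surjective hle') ih h
    · rw [← LinearMap.ker_eq_bot, LinearMap.ker_eq_bot']
      intro y hy
      obtain ⟨y, rfl⟩ := Submodule.Quotient.mk_surjective _ y
      rw [Submodule.mapQ_apply, Submodule.Quotient.mk_eq_zero] at hy
      obtain ⟨z, -, hz⟩ := (Submodule.mem_smul_pointwise_iff_exists _ _ _).mp hy
      refine (Submodule.Quotient.mk_eq_zero _).mpr ?_
      rw [Submodule.mem_smul_pointwise_iff_exists]
      refine ⟨z, trivial, hr ?_⟩
      change r • r ^ (t + 1) • z = r • y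
      rw [smul_smul, ← pow_succ', hz]
      rfl
    · intro y
      obtain ⟨y, rfl⟩ := Submodule.Quotient.mk_surjective _ y
      constructor
      · intro hy
        have hy' : y ∈ r • (⊤ : Submodule R M) := (Submodule.Quotient.mk_eq_zero _).mp hy
        obtain ⟨z, -, rfl⟩ := (Submodule.mem_smul_pointwise_iff_exists _ _ _).mp hy'
        exact ⟨Submodule.Quotient.mk z, rfl⟩
      · rintro ⟨z, hz⟩
        obtain ⟨z, rfl⟩ := Submodule.Quotient.mk_surjective _ z
        rw [← hz]
        refine (Submodule.Quotient.mk_eq_zero _).mpr ?_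
        rw [Submodule.mem_smul_pointwise_iff_exists]
        exact ⟨z, trivial, rfl⟩

theorem isWeaklyRegular_pow {R : Type u} [CommRing R] {rs : List R} {M : Type v}
    [AddCommGroup M] [Module R M] (h : IsWeaklyRegular M rs) (t : ℕ) :
    IsWeaklyRegular M (rs.map (· ^ (t + 1))) := by
  induction rs generalizing M with
  | nil => exact .nil _ _
  | cons r rs ih =>
    rw [isWeaklyRegular_cons_iff] at h
    rw [List.map_cons, isWeaklyRegular_cons_iff]
    exact ⟨h.1.pow _, ih (isWeaklyRegular_quotSMulTop_pow h.1 h.2 t)⟩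

end Regular
end PerfectoidTest
end

noncomputable section

namespace PerfectoidTest

/-! ### Duality by length counting, and Chevalley's theorem. -/

section Matlis

open IsLocalRing

variable {R : Type u} [CommRing R] [IsLocalRing R]

/-- Krull's intersection theorem for R/I. -/
theorem mem_of_forall_mem_sup_pow [IsNoetherianRing R] (I : Ideal R) {a : R}
    (h : ∀ n, a ∈ I ⊔ maximalIdeal R ^ n) : a ∈ I := by
  have h1 := Ideal.iInf_pow_smul_eq_bot_of_isLocalRing (M := R ⧸ I) (maximalIdeal R)
    (maximalIdeal.isMaximal R).ne_top
  rw [← Submodule.Quotient.mk_eq_zero, ← Submodule.mem_bot R, ← h1, Submodule.mem_iInf]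
  intro n
  obtain ⟨b, hb, c, hc, rfl⟩ := Submodule.mem_sup.mp (h n)
  rw [Submodule.Quotient.mk_add, (Submodule.Quotient.mk_eq_zero I).mpr hb, zero_add]
  have h2 : (Submodule.Quotient.mk c : R ⧸ I) = c • Submodule.Quotient.mk 1 := by
    rw [← Submodule.Quotient.mk_smul, smul_eq_mul, mul_one]
  rw [h2]
  exact Submodule.smul_mem_smul hc trivial

/-- For the least k with 𝔪^k I' ⊆ I, which is positive, take an element of 𝔪^{k-1} I' outside I. -/
theorem exists_socle {I I' : Ideal R} (hlt : I < I') {n : ℕ} (hn : maximalIdeal R ^ n ≤ I) :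
    ∃ a ∈ I', a ∉ I ∧ ∀ b ∈ maximalIdeal R, b * a ∈ I := by
  classical
  have hex : ∃ k, maximalIdeal R ^ k * I' ≤ I := ⟨n, Ideal.mul_le_left.trans hn⟩
  obtain ⟨k, hk, hmin⟩ : ∃ k, maximalIdeal R ^ k * I' ≤ I ∧
      ∀ l < k, ¬ maximalIdeal R ^ l * I' ≤ I :=
    ⟨Nat.find hex, Nat.find_spec hex, fun l hl => Nat.find_min hex hl⟩
  obtain _ | k := k
  · rw [pow_zero, Ideal.one_eq_top, Ideal.top_mul] at hk
    exact absurd hk (not_le_of_gt hlt)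
  · obtain ⟨a, ha, haI⟩ := SetLike.not_le_iff_exists.mp (hmin k k.lt_succ_self)
    refine ⟨a, Ideal.mul_le_right ha, haI, fun b hb => hk ?_⟩
    rw [pow_succ', mul_assoc]
    exact Ideal.mul_mem_mul hb ha

theorem length_quotient_maximalIdeal : Module.length R (R ⧸ maximalIdeal R) = 1 := by
  rw [Module.length_eq_one_iff]
  exact (isSimpleModule_iff_isCoatom).mpr (maximalIdeal.isMaximal R).out

/-- The kernel of R/I → R/(I + (a)) is generated by the class of `a`, whose annihilator is 𝔪, so it
is a copy of the residue field. -/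
theorem length_quotient_sup_span {I : Ideal R} {a : R} (ha : a ∉ I)
    (hm : ∀ b ∈ maximalIdeal R, b * a ∈ I) :
    Module.length R (R ⧸ I) = 1 + Module.length R (R ⧸ (I ⊔ Ideal.span {a})) := by
  have hle : maximalIdeal R ≤ LinearMap.ker (I.mkQ ∘ₗ LinearMap.toSpanSingleton R R a) :=
    fun b hb => (Submodule.Quotient.mk_eq_zero I).mpr (hm b hb)
  have hker : LinearMap.ker (I.mkQ ∘ₗ LinearMap.toSpanSingleton R R a) = maximalIdeal R := by
    refine ((maximalIdeal.isMaximal R).eq_of_le ?_ hle).symm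
    intro h
    apply ha
    have h1 : (1 : R) ∈ LinearMap.ker (I.mkQ ∘ₗ LinearMap.toSpanSingleton R R a) := by
      rw [h]; trivial
    have h2 := (Submodule.Quotient.mk_eq_zero I).mp (LinearMap.mem_ker.mp h1)
    rwa [LinearMap.toSpanSingleton_apply, one_smul] at h2
  rw [← length_quotient_maximalIdeal (R := R)]
  refine Module.length_eq_add_of_exact
    ((maximalIdeal R).liftQ (I.mkQ ∘ₗ LinearMap.toSpanSingleton R R a) hle)
    (Submodule.factor le_sup_left) ?_ (Submodule.factor_surjective _) ?_
  · rw [← LinearMap.ker_eq_bot, Submodule.ker_liftQ_eq_bot' _ _ hker.symm]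
  · intro y
    obtain ⟨y, rfl⟩ := Submodule.Quotient.mk_surjective _ y
    constructor
    · intro hy
      have hy' : y ∈ I ⊔ Ideal.span {a} := (Submodule.Quotient.mk_eq_zero _).mp hy
      obtain ⟨b, hb, c, hc, rfl⟩ := Submodule.mem_sup.mp hy'
      obtain ⟨r, rfl⟩ := Ideal.mem_span_singleton'.mp hc
      refine ⟨Submodule.Quotient.mk r, ?_⟩
      change Submodule.Quotient.mk (r • a) = _
      rw [Submodule.Quotient.mk_add, (Submodule.Quotient.mk_eq_zero I).mpr hb, zero_add]
      rfl
    · rintro ⟨z, hz⟩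
      obtain ⟨r, rfl⟩ := Submodule.Quotient.mk_surjective _ z
      rw [← hz]
      refine (Submodule.Quotient.mk_eq_zero (I ⊔ Ideal.span {a})).mpr ?_
      exact Ideal.mem_sup_right (Ideal.mem_span_singleton'.mpr ⟨r, rfl⟩)

theorem lt_sup_span {R : Type u} [CommRing R] {I : Ideal R} {a : R} (ha : a ∉ I) : I < I ⊔ Ideal.span {a} :=
  lt_of_le_of_ne le_sup_left fun h =>
    ha (by rw [h]; exact Ideal.mem_sup_right (Ideal.mem_span_singleton_self a))

theorem length_quotient_ne_top [IsNoetherianRing R] {I : Ideal R} {n : ℕ}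
    (hn : maximalIdeal R ^ n ≤ I) :
    Module.length R (R ⧸ I) ≠ ⊤ := by
  induction I using IsNoetherian.induction with
  | hgt I ih =>
    by_cases hI : I = ⊤
    · subst hI
      have : Module.length R (R ⧸ (⊤ : Ideal R)) = 0 :=
        Module.length_eq_zero_iff.mpr (Ideal.Quotient.subsingleton_iff.mpr rfl)
      rw [this]
      exact ENat.zero_ne_top
    · obtain ⟨a, -, haI, hm⟩ := exists_socle (lt_top_iff_ne_top.mpr hI) hn
      rw [length_quotient_sup_span haI hm]
      exact by
        have := ih _ (lt_sup_span haI) (hn.trans le_sup_left)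
        simpa using this

/-- R/𝔪^j is Artinian, so the images of the `I t` in it stabilise. -/
theorem exists_le_iInf_sup_pow [IsNoetherianRing R] (I : ℕ → Ideal R) (hI : Antitone I)
    (j : ℕ) : ∃ T, I T ≤ ⨅ t, I t ⊔ maximalIdeal R ^ j := by
  have h1 : IsFiniteLength R (R ⧸ maximalIdeal R ^ j) :=
    Module.length_ne_top_iff.mp (length_quotient_ne_top le_rfl)
  have h2 := (isFiniteLength_iff_isNoetherian_isArtinian.mp h1).2
  obtain ⟨T, hT⟩ := IsArtinian.monotone_stabilizes
    (⟨fun t => OrderDual.toDual (Submodule.map (maximalIdeal R ^ j).mkQ (I t)),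
      fun s t hst => Submodule.map_mono (hI hst)⟩ :
      ℕ →o (Submodule R (R ⧸ maximalIdeal R ^ j))ᵒᵈ)
  refine ⟨T, le_iInf fun t => ?_⟩
  rcases le_total T t with h | h
  · have h3 : Submodule.map (maximalIdeal R ^ j).mkQ (I T) =
        Submodule.map (maximalIdeal R ^ j).mkQ (I t) :=
      congrArg OrderDual.ofDual (hT t h)
    have h4 := congrArg (Submodule.comap (maximalIdeal R ^ j).mkQ) h3
    rw [Submodule.comap_map_mkQ, Submodule.comap_map_mkQ] at h4
    rw [sup_comm, ← h4]
    exact le_sup_right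
  · exact (hI h).trans le_sup_left

/-- Chevalley's theorem. -/
theorem exists_le_iInf_sup_pow_of_isPrecomplete [IsNoetherianRing R]
    [IsPrecomplete (maximalIdeal R) R]
    (I : ℕ → Ideal R) (hI : Antitone I) (n : ℕ) : ∃ T, I T ≤ (⨅ t, I t) ⊔ maximalIdeal R ^ n := by
  have hle : ∀ {i j : ℕ}, i ≤ j → (⨅ t, I t ⊔ maximalIdeal R ^ j) ≤
      ⨅ t, I t ⊔ maximalIdeal R ^ i := fun h => iInf_mono fun t => sup_le_sup_left
        (Ideal.pow_le_pow_right h) _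
  obtain ⟨T, hT⟩ := exists_le_iInf_sup_pow I hI n
  refine ⟨T, fun b hb => ?_⟩
  -- Successive approximation starting at `b`: each correction lies in 𝔪^k and improves membership
  -- in all I_t + 𝔪^k to membership in all I_t + 𝔪^{k+1}. The limit `L` lies in every I_t by Krull's
  -- theorem, and b - L ∈ 𝔪^n.
  have hstep : ∀ k, ∀ c : (⨅ t, I t ⊔ maximalIdeal R ^ k : Ideal R),
      ∃ c' : (⨅ t, I t ⊔ maximalIdeal R ^ (k + 1) : Ideal R),
      (c' : R) - c ∈ maximalIdeal R ^ k := by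
    rintro k ⟨c, hc⟩
    obtain ⟨T', hT'⟩ := exists_le_iInf_sup_pow I hI (k + 1)
    obtain ⟨c', hc', z, hz, rfl⟩ := Submodule.mem_sup.mp ((Submodule.mem_iInf _).mp hc T')
    refine ⟨⟨c', hT' hc'⟩, ?_⟩
    rw [sub_add_cancel_left]
    exact neg_mem hz
  choose next hnext using hstep
  let c : ∀ k, (⨅ t, I t ⊔ maximalIdeal R ^ (n + k) : Ideal R) :=
    fun k => Nat.rec (motive := fun k => (⨅ t, I t ⊔ maximalIdeal R ^ (n + k) : Ideal R))
      ⟨b, hT hb⟩ (fun k c => next (n + k) c) k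
  have hc0 : (c 0 : R) = b := rfl
  have hc : ∀ k, (c (k + 1) : R) - c k ∈ maximalIdeal R ^ (n + k) := fun k => hnext _ _
  have hc' : ∀ {j k}, j ≤ k → (c k : R) - c j ∈ maximalIdeal R ^ (n + j) := by
    intro j k hjk
    induction k, hjk using Nat.le_induction with
    | base => rw [sub_self]; exact zero_mem _
    | succ k hjk ih =>
      rw [← sub_add_sub_cancel]
      exact add_mem (Ideal.pow_le_pow_right (by omega) (hc k)) ih
  obtain ⟨L, hL⟩ := IsPrecomplete.prec (I := maximalIdeal R) (M := R) inferInstance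
    (f := fun k => (c k : R)) (by
      intro j k hjk
      rw [SModEq.sub_mem, smul_eq_mul, Ideal.mul_top, ← neg_mem_iff, neg_sub]
      exact Ideal.pow_le_pow_right (by omega) (hc' hjk))
  simp only [SModEq.sub_mem, smul_eq_mul, Ideal.mul_top] at hL
  rw [show b = L + (b - L) by ring]
  refine Submodule.add_mem_sup ?_ ?_
  · refine (Submodule.mem_iInf _).mpr fun t => mem_of_forall_mem_sup_pow _ fun k => ?_
    rw [show L = c k - (c k - L) by ring]
    exact sub_mem ((Submodule.mem_iInf _).mp (hle (by omega : k ≤ n + k) (c k).2) t)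
      (Ideal.mem_sup_right (hL k))
  · rw [show b - L = (c n - L) - (c n - c 0) by rw [hc0]; ring]
    exact sub_mem (hL n) (Ideal.pow_le_pow_right (by omega) (hc' (Nat.zero_le n)))

variable {H : Type u} [AddCommGroup H] [Module R H]

/-- Multiplication by `a` maps the `I`-torsion to the 𝔪-torsion, with kernel the torsion by I + (a).
-/
theorem length_torsionBySet_le_add (I : Ideal R) {a : R}
    (hm : ∀ b ∈ maximalIdeal R, b * a ∈ I) :
    Module.length R (Submodule.torsionBySet R H (I : Set R)) ≤
      Module.length R (Submodule.torsionBySet R H ((I ⊔ Ideal.span {a} : Ideal R) : Set R)) +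
        Module.length R (Submodule.torsionBySet R H (maximalIdeal R : Set R)) := by
  have hle : Submodule.torsionBySet R H ((I ⊔ Ideal.span {a} : Ideal R) : Set R) ≤
      Submodule.torsionBySet R H (I : Set R) :=
    Submodule.torsionBySet_le_torsionBySet_of_subset (SetLike.coe_subset_coe.mpr le_sup_left)
  let φ : Submodule.torsionBySet R H (I : Set R) →ₗ[R]
      Submodule.torsionBySet R H (maximalIdeal R : Set R) :=
    (LinearMap.lsmul R H a).restrict fun x hx => by
      rw [Submodule.mem_torsionBySet_iff] at hx ⊢
      rintro ⟨b, hb⟩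
      exact (smul_smul b a x).trans (hx ⟨_, hm b hb⟩)
  rw [Module.length_eq_add_of_exact (Submodule.inclusion hle) φ.rangeRestrict
    (Submodule.inclusion_injective hle) φ.surjective_rangeRestrict]
  · gcongr
    exact Module.length_le_of_injective _ (LinearMap.range φ).injective_subtype
  · intro x
    rw [← LinearMap.mem_ker, LinearMap.ker_rangeRestrict]
    constructor
    · intro hx
      have hx' : a • (x : H) = 0 := congrArg Subtype.val (LinearMap.mem_ker.mp hx)
      refine ⟨⟨x, ?_⟩, rfl⟩
      rw [Submodule.mem_torsionBySet_iff]
      rintro ⟨y, hy⟩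
      obtain ⟨b, hb, z, hz, rfl⟩ := Submodule.mem_sup.mp hy
      obtain ⟨r, rfl⟩ := Ideal.mem_span_singleton'.mp hz
      change (b + r * a) • (x : H) = 0
      rw [add_smul, mul_smul, hx', smul_zero, add_zero]
      exact (Submodule.mem_torsionBySet_iff _ _).mp x.2 ⟨b, hb⟩
    · rintro ⟨y, rfl⟩
      refine LinearMap.mem_ker.mpr (Subtype.ext ?_)
      exact (Submodule.mem_torsionBySet_iff _ _).mp y.2
        ⟨a, Ideal.mem_sup_right (Ideal.mem_span_singleton_self a)⟩

/-- A module all of whose elements are `𝔪`-power torsion, with the annihilators of a cofinal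
sequence of `𝔪`-primary ideals `q t` isomorphic to the `R ⧸ q t`. -/
structure IsMatlis (H : Type u) [AddCommGroup H] [Module R H] (q : ℕ → Ideal R) : Prop where
  antitone : Antitone q
  zero : q 0 = maximalIdeal R
  le_pow : ∀ t, q t ≤ maximalIdeal R ^ t
  exists_pow_le : ∀ t, ∃ n, maximalIdeal R ^ n ≤ q t
  equiv : ∀ t, Nonempty ((R ⧸ q t) ≃ₗ[R] Submodule.torsionBySet R H (q t : Set R))
  torsion : ∀ x : H, ∃ n, ∀ r ∈ maximalIdeal R ^ n, r • x = 0

namespace IsMatlis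

variable {q : ℕ → Ideal R} (hH : IsMatlis H q)
include hH

theorem length_torsionBySet_maximalIdeal :
    Module.length R (Submodule.torsionBySet R H (maximalIdeal R : Set R)) = 1 := by
  obtain ⟨e⟩ := hH.equiv 0
  rw [hH.zero] at e
  rw [← e.length_eq, length_quotient_maximalIdeal]

variable [IsNoetherianRing R]

/-- Enlarging I by a socle element lowers the length of R/I by exactly one and that of the
`I`-torsion by at most one, since the socle of `H` has length one. Start from the unit ideal. -/
theorem length_torsionBySet_le {I : Ideal R} {n : ℕ} (hn : maximalIdeal R ^ n ≤ I) :
    Module.length R (Submodule.torsionBySet R H (I : Set R)) ≤ Module.length R (R ⧸ I) := by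
  induction I using IsNoetherian.induction with
  | hgt I ih =>
    by_cases hI : I = ⊤
    · subst hI
      have : Subsingleton (Submodule.torsionBySet R H ((⊤ : Ideal R) : Set R)) := by
        refine ⟨fun x y => Subtype.ext ?_⟩
        have h1 : ∀ z : Submodule.torsionBySet R H ((⊤ : Ideal R) : Set R), (z : H) = 0 :=
          fun z => by
            have := (Submodule.mem_torsionBySet_iff _ _).mp z.2 ⟨1, trivial⟩
            rwa [one_smul] at this
        rw [h1, h1]
      rw [Module.length_eq_zero_iff.mpr this]
      exact zero_le
    · obtain ⟨a, -, haI, hm⟩ := exists_socle (lt_top_iff_ne_top.mpr hI) hn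
      refine (length_torsionBySet_le_add I hm).trans ?_
      rw [length_quotient_sup_span haI hm, hH.length_torsionBySet_maximalIdeal, add_comm]
      gcongr
      exact ih _ (lt_sup_span haI) (hn.trans le_sup_left)

/-- The same comparison of socle steps, read upwards from `I` to `I'`. Applied to `q t`, where
equality holds, it covers every ideal containing some `q t`. -/
theorem length_quotient_le {I I' : Ideal R} {n : ℕ} (hn : maximalIdeal R ^ n ≤ I) (hII' : I ≤ I')
    (hI : Module.length R (R ⧸ I) ≤ Module.length R (Submodule.torsionBySet R H (I : Set R))) :
    Module.length R (R ⧸ I') ≤ Module.length R (Submodule.torsionBySet R H (I' : Set R)) := by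
  induction I using IsNoetherian.induction with
  | hgt I ih =>
    rcases hII'.eq_or_lt with rfl | hlt
    · exact hI
    · obtain ⟨a, ha, haI, hm⟩ := exists_socle hlt hn
      refine ih _ (lt_sup_span haI) (hn.trans le_sup_left)
        (sup_le hII' ((Ideal.span_singleton_le_iff_mem _).mpr ha)) ?_
      have h1 := hI.trans (length_torsionBySet_le_add I hm)
      rw [length_quotient_sup_span haI hm, hH.length_torsionBySet_maximalIdeal, add_comm] at h1
      exact (ENat.add_le_add_iff_right ENat.one_ne_top).mp h1

/-- If a ∉ I, then I and I + (a) have the same torsion in `H`. By the two length bounds R/I would be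
no longer than R/(I + (a)). -/
theorem mem_of_forall_smul_eq_zero_of_le {I : Ideal R} {t : ℕ} (ht : q t ≤ I) {a : R}
    (ha : ∀ x : H, (∀ b ∈ I, b • x = 0) → a • x = 0) : a ∈ I := by
  obtain ⟨n, hn⟩ := hH.exists_pow_le t
  by_contra haI
  have hle := hH.length_quotient_le hn ht (by
    obtain ⟨e⟩ := hH.equiv t
    exact e.length_eq.le)
  have heq : Submodule.torsionBySet R H ((I ⊔ Ideal.span {a} : Ideal R) : Set R) =
      Submodule.torsionBySet R H (I : Set R) := by
    refine le_antisymm (Submodule.torsionBySet_le_torsionBySet_of_subset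
      (SetLike.coe_subset_coe.mpr le_sup_left)) fun x hx => ?_
    rw [Submodule.mem_torsionBySet_iff] at hx ⊢
    rintro ⟨y, hy⟩
    obtain ⟨b, hb, z, hz, rfl⟩ := Submodule.mem_sup.mp hy
    obtain ⟨r, rfl⟩ := Ideal.mem_span_singleton'.mp hz
    change (b + r * a) • x = 0
    rw [add_smul, mul_smul, ha x fun b hb => hx ⟨b, hb⟩, smul_zero, add_zero]
    exact hx ⟨b, hb⟩
  have hle' := hH.length_torsionBySet_le (I := I ⊔ Ideal.span {a})
    ((hn.trans ht).trans le_sup_left)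
  rw [heq] at hle'
  -- A socle element of I + (a) modulo I makes the drop in length strict.
  obtain ⟨c, hc, hcI, hm⟩ := exists_socle (lt_sup_span haI) (hn.trans ht)
  have h1 : Module.length R (R ⧸ (I ⊔ Ideal.span {a})) ≤
      Module.length R (R ⧸ (I ⊔ Ideal.span {c})) :=
    Module.length_le_of_surjective (Submodule.factor
      (sup_le le_sup_left ((Ideal.span_singleton_le_iff_mem _).mpr hc)))
      (Submodule.factor_surjective _)
  have h2 := (hle.trans hle').trans h1
  rw [length_quotient_sup_span hcI hm] at h2
  have hfin := length_quotient_ne_top (I := I ⊔ Ideal.span {c})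
    ((hn.trans ht).trans le_sup_left)
  obtain ⟨l, hl⟩ := ENat.ne_top_iff_exists.mp hfin
  rw [← hl] at h2
  norm_cast at h2
  omega

/-- I is the intersection of the I + 𝔪^t, and each I + q_t is covered by the previous lemma. -/
theorem mem_of_forall_smul_eq_zero {I : Ideal R} {a : R}
    (ha : ∀ x : H, (∀ b ∈ I, b • x = 0) → a • x = 0) : a ∈ I := by
  refine mem_of_forall_mem_sup_pow I fun t => ?_
  refine sup_le_sup_left (hH.le_pow t) I (hH.mem_of_forall_smul_eq_zero_of_le
    (le_sup_right : q t ≤ _) fun x hx => ha x fun b hb => hx b (Ideal.mem_sup_left hb))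

/-- Chevalley's theorem reduces from `N` to its part killed by some `q t`, inside the cyclic module
H[q_t] ≅ R/q_t. There the claim becomes the double annihilator property of the ideal (N : h₀), with
h₀ a generator. -/
theorem mem_of_forall_annihilator_smul_eq_zero [IsPrecomplete (maximalIdeal R) R]
    (N : Submodule R H) {x : H} (hx : ∀ a ∈ N.annihilator, a • x = 0) : x ∈ N := by
  obtain ⟨n, hn⟩ := hH.torsion x
  let I : ℕ → Ideal R := fun t =>
    (N ⊓ Submodule.torsionBySet R H (q t : Set R)).annihilator
  have hI : Antitone I := fun s t hst => Submodule.annihilator_mono (inf_le_inf_left _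
    (Submodule.torsionBySet_le_torsionBySet_of_subset
      (SetLike.coe_subset_coe.mpr (hH.antitone hst))))
  have hinf : ⨅ t, I t ≤ N.annihilator := by
    intro a ha
    rw [Submodule.mem_annihilator]
    intro y hy
    obtain ⟨m, hm⟩ := hH.torsion y
    exact Submodule.mem_annihilator.mp ((Submodule.mem_iInf _).mp ha m) y
      ⟨hy, (Submodule.mem_torsionBySet_iff _ _).mpr fun r => hm r (hH.le_pow m r.2)⟩
  -- As 𝔪^n and Ann N both kill `x`, so does I_t for large t.
  obtain ⟨T, hT⟩ := exists_le_iInf_sup_pow_of_isPrecomplete I hI n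
  obtain ⟨t, htT, htn⟩ : ∃ t, T ≤ t ∧ n ≤ t := ⟨max T n, le_max_left _ _, le_max_right _ _⟩
  have hIx : ∀ a ∈ I t, a • x = 0 := by
    intro a ha
    obtain ⟨b, hb, c, hc, rfl⟩ := Submodule.mem_sup.mp (hT (hI htT ha))
    rw [add_smul, hx b (hinf hb), hn c hc, add_zero]
  obtain ⟨e⟩ := hH.equiv t
  have hgen : ∀ y : H, (∀ r ∈ q t, r • y = 0) →
      ∃ c : R, y = c • (e (Ideal.Quotient.mk _ 1) : H) := by
    intro y hy
    obtain ⟨z, hz⟩ := e.surjective ⟨y, (Submodule.mem_torsionBySet_iff _ _).mpr fun r => hy r r.2⟩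
    obtain ⟨c, rfl⟩ := Ideal.Quotient.mk_surjective z
    refine ⟨c, ?_⟩
    rw [← Submodule.coe_smul, ← map_smul]
    have : c • (Ideal.Quotient.mk (q t) 1) = Ideal.Quotient.mk (q t) c := by
      rw [← Ideal.Quotient.mk_eq_mk, ← Submodule.Quotient.mk_smul, smul_eq_mul, mul_one]
      rfl
    rw [this, hz]
  set h₀ : H := (e (Ideal.Quotient.mk _ 1) : H) with hh₀
  have hh₀' : ∀ r ∈ q t, r • h₀ = 0 := fun r hr =>
    (Submodule.mem_torsionBySet_iff _ _).mp (e (Ideal.Quotient.mk _ 1)).2 ⟨r, hr⟩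
  obtain ⟨a, rfl⟩ := hgen x fun r hr =>
    hn r (Ideal.pow_le_pow_right htn (hH.le_pow t hr))
  -- If y = c h₀ is killed by (N : h₀), then c kills N ∩ H[q_t], so c ∈ I_t and a y = c x = 0.
  have hmem : a ∈ N.comap (LinearMap.toSpanSingleton R H h₀) := by
    refine hH.mem_of_forall_smul_eq_zero_of_le (t := t) (fun r hr => ?_) fun y hy => ?_
    · rw [Submodule.mem_comap, LinearMap.toSpanSingleton_apply, hh₀' r hr]
      exact zero_mem _
    · obtain ⟨c, rfl⟩ := hgen y fun r hr => hy r (by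
        rw [Submodule.mem_comap, LinearMap.toSpanSingleton_apply, hh₀' r hr]
        exact zero_mem _)
      rw [smul_comm]
      refine hIx c (Submodule.mem_annihilator.mpr ?_)
      rintro z ⟨hzN, hzt⟩
      obtain ⟨b, rfl⟩ := hgen z fun r hr => (Submodule.mem_torsionBySet_iff _ _).mp hzt ⟨r, hr⟩
      rw [smul_comm]
      exact hy b hzN
  exact hmem

end IsMatlis
end Matlis
end PerfectoidTest
end

noncomputable section

namespace PerfectoidTest

/-! ### Top local cohomology of a regular local ring satisfies the duality. -/

section LocalCohomologyMatlis

open IsLocalRing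

theorem exists_isMatlis_localCohomology {R : Type u} [CommRing R] [IsRegularLocalRing R] {n : ℕ}
    (hn : ringKrullDim R = (n + 1 : ℕ)) : ∃ q : ℕ → Ideal R, IsMatlis (H R (n + 1) R) q := by
  obtain ⟨rs, hlen, hrs, hreg⟩ := exists_isWeaklyRegular_of_isRegularLocalRing (R := R)
  have hlen' : n + 1 = rs.length := by
    rw [hlen]
    rw [← IsRegularLocalRing.spanFinrank_maximalIdeal] at hn
    exact_mod_cast hn.symm
  have hmem : ∀ r ∈ rs, r ∈ maximalIdeal R := fun r hr => by
    rw [← hrs]; exact Ideal.subset_span hr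
  -- The exponent t + 1 makes q_0 = 𝔪 and keeps q_t ⊆ 𝔪^t.
  let q : ℕ → Ideal R := fun t => Ideal.ofList (rs.map (· ^ (t + 1)))
  have hqle : ∀ {t : ℕ} {I : Ideal R}, (∀ r ∈ rs, r ^ (t + 1) ∈ I) → q t ≤ I := by
    intro t I h
    refine Ideal.span_le.mpr ?_
    intro x hx
    obtain ⟨r, hr, rfl⟩ := List.mem_map.mp hx
    exact h r hr
  have hqmem : ∀ {t : ℕ} {r : R}, r ∈ rs → r ^ (t + 1) ∈ q t := fun hr =>
    Ideal.subset_span (List.mem_map.mpr ⟨_, hr, rfl⟩)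
  have hpow : ∀ t, ∃ m, maximalIdeal R ^ m ≤ q t := by
    intro t
    refine Ideal.exists_pow_le_of_le_radical_of_fg ?_ (IsNoetherian.noetherian _)
    rw [← hrs]
    exact Ideal.span_le.mpr fun r hr => ⟨t + 1, hqmem hr⟩
  let e := LinearEquiv.ofBijective _
    (limExtToLocalCohomology_bijective (J := maximalIdeal R) n (ModuleCat.of R R))
  refine ⟨q, ⟨?_, ?_, ?_, hpow, ?_, ?_⟩⟩
  · intro t s hst
    exact hqle fun r hr => Ideal.pow_mem_of_pow_mem _ (hqmem (t := t) hr) (by omega)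
  · simp only [q, zero_add, pow_one, List.map_id']
    exact hrs
  · exact fun t => hqle fun r hr => Ideal.pow_le_pow_right t.le_succ (Ideal.pow_mem_pow (hmem r hr) _)
  · intro t
    obtain ⟨s, hs⟩ := hpow t
    have htop : (Ideal.ofList (rs.map (· ^ (t + 1))) • ⊤ : Submodule R R) = q t := by
      rw [smul_eq_mul, Ideal.mul_top]
    obtain ⟨φ⟩ := nonempty_torsionBySet_limExt_equiv (J := maximalIdeal R)
      (rs := rs.map (· ^ (t + 1))) (by
        intro x hx
        obtain ⟨r, hr, rfl⟩ := List.mem_map.mp hx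
        exact Ideal.pow_mem_of_mem _ (hmem r hr) _ (by omega)) R
      (isWeaklyRegular_pow hreg t) (s := s) (by
        intro a ha y
        obtain ⟨y, rfl⟩ := Submodule.Quotient.mk_surjective _ y
        rw [← Submodule.Quotient.mk_smul, Submodule.Quotient.mk_eq_zero, htop, smul_eq_mul]
        exact Ideal.mul_mem_right _ _ (hs ha)) (n := n + 1) (by rw [List.length_map, hlen'])
    refine ⟨Submodule.quotEquivOfEq _ _ htop.symm ≪≫ₗ φ ≪≫ₗ
      LinearEquiv.ofSubmodules e _ _ ?_⟩
    rw [← Submodule.torsionBySet_eq_torsionBySet_span]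
    ext y
    rw [Submodule.mem_map]
    constructor
    · rintro ⟨x, hx, rfl⟩
      rw [Submodule.mem_torsionBySet_iff] at hx ⊢
      intro a
      exact (map_smul e (a : R) x).symm.trans ((congrArg e (hx a)).trans (map_zero e))
    · intro hy
      refine ⟨e.symm y, ?_, e.apply_symm_apply y⟩
      rw [Submodule.mem_torsionBySet_iff] at hy ⊢
      intro a
      exact (map_smul e.symm (a : R) y).symm.trans ((congrArg e.symm (hy a)).trans (map_zero _))
  · intro y
    obtain ⟨t, ht⟩ := exists_pow_smul_limExt_eq_zero (e.symm y)
    refine ⟨t, fun r hr => ?_⟩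
    have h := congrArg e (ht r hr)
    rwa [map_smul, e.apply_symm_apply, map_zero] at h

end LocalCohomologyMatlis
end PerfectoidTest
end

noncomputable section

namespace PerfectoidTest

/-! ### The kernel of M' ⊗ X → M ⊗ X is controlled by Tor₁ of the cokernel. -/

section TorChase

open TensorProduct MonoidalCategory

variable {R : Type u} [CommRing R]

theorem exists_d_eq_of_homologyMap_eq_zero {K L : ChainComplex (ModuleCat.{u} R) ℕ} (ψ : K ⟶ L)
    (h : HomologicalComplex.homologyMap ψ 1 = 0) (w : K.X 1) (hw : (K.d 1 0).hom w = 0) :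
    ∃ u : L.X 2, (L.d 2 1).hom u = (ψ.f 1).hom w := by
  let k : ModuleCat.of R R ⟶ K.X 1 := ModuleCat.ofHom (LinearMap.toSpanSingleton R _ w)
  have hk : k ≫ K.d 1 0 = 0 := by
    ext
    change (K.d 1 0).hom ((1 : R) • w) = 0
    rw [one_smul, hw]
  let z := K.liftCycles k 0 (by simp) hk
  have hz : (z ≫ HomologicalComplex.cyclesMap ψ 1) ≫ L.homologyπ 1 = 0 := by
    rw [Category.assoc, ← HomologicalComplex.homologyπ_naturality, h, Limits.comp_zero,
      Limits.comp_zero]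
  have hex := ShortComplex.exact_of_g_is_cokernel
    (ShortComplex.mk (L.toCycles 2 1) (L.homologyπ 1) (by simp))
    (L.homologyIsCokernel 2 1 (by simp))
  rw [ShortComplex.moduleCat_exact_iff] at hex
  obtain ⟨u, hu⟩ := hex ((z ≫ HomologicalComplex.cyclesMap ψ 1).hom (1 : R))
    (congrArg (fun φ => φ.hom (1 : R)) hz)
  refine ⟨u, ?_⟩
  have h1 : z ≫ HomologicalComplex.cyclesMap ψ 1 ≫ L.iCycles 1 = k ≫ ψ.f 1 := by
    rw [HomologicalComplex.cyclesMap_i, HomologicalComplex.liftCycles_i_assoc]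
  have h2 : (L.iCycles 1).hom ((L.toCycles 2 1).hom u) = (L.d 2 1).hom u :=
    congrArg (fun φ => φ.hom u) (L.toCycles_i 2 1)
  rw [← h2]
  refine (congrArg (L.iCycles 1).hom hu).trans ?_
  refine (congrArg (fun φ => φ.hom (1 : R)) h1).trans ?_
  change (ψ.f 1).hom ((1 : R) • w) = _
  rw [one_smul]

theorem eq_zero_of_iso_hom_comp_comp_iso_inv_eq_zero {C : Type*} [Category* C]
    [Preadditive C] {X Y Z W : C} (e : X ≅ Y) (f : Y ⟶ Z) (e' : W ≅ Z)
    (h : e.hom ≫ f ≫ e'.inv = 0) : f = 0 := by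
  rwa [Preadditive.IsIso.comp_left_eq_zero, Preadditive.IsIso.comp_right_eq_zero] at h

theorem exists_lTensor_d_eq_of_tor_map_eq_zero {M X : ModuleCat.{u} R} {c : X ⟶ X}
    (h : ((Tor (ModuleCat.{u} R) 1).obj M).map c = 0) (P : ProjectiveResolution X)
    {g : P.complex ⟶ P.complex}
    (hg : g ≫ P.π = P.π ≫ (ChainComplex.single₀ (ModuleCat.{u} R)).map c)
    (w : M ⊗[R] P.complex.X 1) (hw : (P.complex.d 1 0).hom.lTensor M w = 0) :
    ∃ u : M ⊗[R] P.complex.X 2,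
      (P.complex.d 2 1).hom.lTensor M u = (g.f 1).hom.lTensor M w := by
  have h1 := Functor.leftDerived_map_eq ((tensoringLeft (ModuleCat.{u} R)).obj M) 1 c
    (P := P) (Q := P) g hg
  have h2 : (((tensoringLeft (ModuleCat.{u} R)).obj M).leftDerived 1).map c = 0 := h
  rw [h2] at h1
  have h3 : HomologicalComplex.homologyMap
      ((((tensoringLeft (ModuleCat.{u} R)).obj M).mapHomologicalComplex _).map g) 1 = 0 :=
    eq_zero_of_iso_hom_comp_comp_iso_inv_eq_zero _ _ _ h1.symm
  exact exists_d_eq_of_homologyMap_eq_zero _ h3 w hw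

theorem lTensor_lTensor_comm {M M' N N' : Type u} [AddCommGroup M] [Module R M]
    [AddCommGroup M'] [Module R M'] [AddCommGroup N] [Module R N] [AddCommGroup N'] [Module R N']
    (j : M →ₗ[R] M') (f : N →ₗ[R] N') (x : M ⊗[R] N) :
    f.lTensor M' (j.rTensor N x) = j.rTensor N' (f.lTensor M x) := by
  rw [← LinearMap.comp_apply, ← LinearMap.comp_apply, LinearMap.lTensor_comp_rTensor,
    LinearMap.rTensor_comp_lTensor]

/-- The kernel is the image of Tor₁(M/M', X) under the connecting map, naturally in X. Since Tor is
derived in X, `c` is lifted to a projective resolution P of X and the connecting map is chased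
through M' ⊗ P, M ⊗ P and (M/M') ⊗ P. -/
theorem lTensor_eq_zero_of_tor_map_eq_zero {M' M : Type u} [AddCommGroup M'] [Module R M']
    [AddCommGroup M] [Module R M] {j : M' →ₗ[R] M} (hj : Function.Injective j) {X : Type u}
    [AddCommGroup X] [Module R X] {c : X →ₗ[R] X}
    (h : ((Tor (ModuleCat.{u} R) 1).obj (ModuleCat.of R (M ⧸ LinearMap.range j))).map
      (ModuleCat.ofHom c) = 0) (x : M' ⊗[R] X) (hx : j.rTensor X x = 0) :
    c.lTensor M' x = 0 := by
  obtain ⟨⟨P⟩⟩ := HasProjectiveResolutions.out (C := ModuleCat.{u} R) (ModuleCat.of R X)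
  let g := ProjectiveResolution.lift (ModuleCat.ofHom c) P P
  have hg : g ≫ P.π = _ := ProjectiveResolution.lift_commutes (ModuleCat.ofHom c) P P
  let q := (LinearMap.range j).mkQ
  have hq : Function.Surjective q := Submodule.mkQ_surjective _
  have hjq : Function.Exact j q := LinearMap.exact_map_mkQ_range j
  let d₁ : P.complex.X 1 →ₗ[R] P.complex.X 0 := (P.complex.d 1 0).hom
  let d₂ : P.complex.X 2 →ₗ[R] P.complex.X 1 := (P.complex.d 2 1).hom
  let π : P.complex.X 0 →ₗ[R] X := (P.π.f 0).hom
  let φ₀ : P.complex.X 0 →ₗ[R] P.complex.X 0 := (g.f 0).hom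
  let φ₁ : P.complex.X 1 →ₗ[R] P.complex.X 1 := (g.f 1).hom
  have hd : d₁ ∘ₗ d₂ = 0 := congrArg ModuleCat.Hom.hom (P.complex.d_comp_d 2 1 0)
  have hπ : Function.Exact d₁ π := fun y =>
    ⟨(ShortComplex.moduleCat_exact_iff _).mp P.exact₀ y, by
      rintro ⟨z, rfl⟩
      exact congrArg (fun φ => φ.hom z) (ShortComplex.mk _ _
        P.complex_d_comp_π_f_zero).zero⟩
  have hπs : Function.Surjective π := (ModuleCat.epi_iff_surjective _).mp inferInstance
  have hφ : d₁ ∘ₗ φ₁ = φ₀ ∘ₗ d₁ := congrArg ModuleCat.Hom.hom (g.comm 1 0)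
  have hφπ : π ∘ₗ φ₀ = c ∘ₗ π := by
    have := congrArg (fun ψ : P.complex ⟶ (ChainComplex.single₀ _).obj (ModuleCat.of R X) =>
      (ψ.f 0).hom) hg
    exact this
  have hflat : Module.Flat R (P.complex.X 0) := by
    have : Module.Projective R (P.complex.X 0) :=
      (IsProjective.iff_projective _).mpr (P.projective 0)
    infer_instance
  obtain ⟨y, rfl⟩ := LinearMap.lTensor_surjective M' hπs x
  obtain ⟨w, hw⟩ := (lTensor_exact M hπ hπs (j.rTensor _ y)).mp (by
    rw [lTensor_lTensor_comm, hx])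
  obtain ⟨u, hu⟩ := exists_lTensor_d_eq_of_tor_map_eq_zero h P hg (q.rTensor _ w) (by
    change d₁.lTensor _ _ = 0
    rw [lTensor_lTensor_comm, hw, ← LinearMap.comp_apply, ← LinearMap.rTensor_comp,
      hjq.linearMap_comp_eq_zero, LinearMap.rTensor_zero, LinearMap.zero_apply])
  obtain ⟨u, rfl⟩ := LinearMap.rTensor_surjective _ hq u
  obtain ⟨v, hv⟩ := (rTensor_exact (P.complex.X 1) hjq hq (φ₁.lTensor M w - d₂.lTensor M u)).mp (by
    rw [map_sub, ← lTensor_lTensor_comm, ← lTensor_lTensor_comm]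
    exact sub_eq_zero.mpr hu.symm)
  -- Checked in M ⊗ P₀, into which M' ⊗ P₀ injects because P₀ is flat. So the lift of `c` sends `y`
  -- to a boundary, which dies in M' ⊗ X.
  have key : φ₀.lTensor M' y = d₁.lTensor M' v := by
    apply Module.Flat.rTensor_preserves_injective_linearMap (M := P.complex.X 0) j hj
    rw [← lTensor_lTensor_comm, ← lTensor_lTensor_comm, hv, map_sub, ← hw]
    simp only [← LinearMap.comp_apply, ← LinearMap.lTensor_comp, hφ, hd]
    simp
  rw [← LinearMap.comp_apply, ← LinearMap.lTensor_comp, ← hφπ, LinearMap.lTensor_comp,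
    LinearMap.comp_apply, key, ← LinearMap.comp_apply, ← LinearMap.lTensor_comp,
    hπ.linearMap_comp_eq_zero, LinearMap.lTensor_zero, LinearMap.zero_apply]

end TorChase

/-! ### Tensoring with an almost flat algebra almost preserves injections. -/

section AlmostFlat

open TensorProduct

variable {p : ℕ} [Fact p.Prime] {A S : Type u} [CommRing A] [CommRing S] [Algebra (Kcirc p) S]
  [Algebra A S]

theorem rTensor_mulLeft_apply {M : Type u} [AddCommGroup M] [Module A M] (c : S) (z : S ⊗[A] M) :
    (LinearMap.mulLeft A c).rTensor M z = c • z := by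
  induction z using TensorProduct.induction_on with
  | zero => rw [map_zero, smul_zero]
  | tmul s m => rfl
  | add x y hx hy => rw [map_add, smul_add, hx, hy]

theorem comm_rTensor_apply {M M' N : Type u} [AddCommGroup M] [Module A M] [AddCommGroup M']
    [Module A M'] [AddCommGroup N] [Module A N] (f : M →ₗ[A] M') (z : M ⊗[A] N) :
    TensorProduct.comm A M' N (f.rTensor N z) = f.lTensor N (TensorProduct.comm A M N z) := by
  induction z using TensorProduct.induction_on with
  | zero => simp only [map_zero]
  | tmul s m => rfl
  | add x y hx hy => simp only [map_add, hx, hy]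

theorem comm_lTensor_apply {M M' N : Type u} [AddCommGroup M] [Module A M] [AddCommGroup M']
    [Module A M'] [AddCommGroup N] [Module A N] (f : M →ₗ[A] M') (z : N ⊗[A] M) :
    TensorProduct.comm A N M' (f.lTensor N z) = f.rTensor N (TensorProduct.comm A N M z) := by
  induction z using TensorProduct.induction_on with
  | zero => simp only [map_zero]
  | tmul s m => rfl
  | add x y hx hy => simp only [map_add, hx, hy]

theorem IsAlmostFlat.smul_eq_zero (h : IsAlmostFlat p A S) {M' M : Type u} [AddCommGroup M']
    [Module A M'] [AddCommGroup M] [Module A M] {j : M' →ₗ[A] M} (hj : Function.Injective j)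
    {z : S ⊗[A] M'} (hz : j.lTensor S z = 0) {k : ℕ} (hk : 0 < k) : pRootIn p S k • z = 0 := by
  have h1 := lTensor_eq_zero_of_tor_map_eq_zero hj (h _ 1 one_pos k hk)
    (TensorProduct.comm A S M' z) (by rw [← comm_lTensor_apply, hz, map_zero])
  rw [← comm_rTensor_apply, rTensor_mulLeft_apply, LinearEquiv.map_eq_zero_iff] at h1
  exact h1

end AlmostFlat
end PerfectoidTest
end

noncomputable section

namespace PerfectoidTest

/-! ### The map S ⊗ Ext^n(M, A) → Ext^n(M, S), and finite free modules. -/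

section TensorExt

open TensorProduct Abelian

variable {A S : Type u} [CommRing A] [CommRing S] [Algebra A S]

variable (A) in
/-- The `A`-linear map `A → S`, `a ↦ a • s`. -/
def scalarHom (s : S) : ModuleCat.of A A ⟶ ModuleCat.of A S :=
  ModuleCat.ofHom (LinearMap.toSpanSingleton A S s)

theorem scalarHom_add (s t : S) : scalarHom A (s + t) = scalarHom A s + scalarHom A t := by
  ext
  change (1 : A) • (s + t) = (1 : A) • s + (1 : A) • t
  rw [smul_add]

theorem scalarHom_smul (a : A) (s : S) : scalarHom A (a • s) = a • scalarHom A s := by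
  ext
  change (1 : A) • a • s = a • (1 : A) • s
  rw [one_smul, one_smul]

variable (A S) in
/-- The map `S ⊗ Ext^n(M, A) → Ext^n(M, S)`. -/
def tensorExt (M : ModuleCat.{u} A) (n : ℕ) :
    S ⊗[A] Ext.{u} M (ModuleCat.of A A) n →ₗ[A] Ext.{u} M (ModuleCat.of A S) n :=
  TensorProduct.lift
    { toFun s := (Ext.mk₀ (scalarHom A s)).postcompOfLinear A M (add_zero n)
      map_add' s t := by
        ext e
        change e.comp (Ext.mk₀ (scalarHom A (s + t))) (add_zero n) = _
        rw [scalarHom_add, Ext.mk₀_add, Ext.comp_add]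
        rfl
      map_smul' a s := by
        ext e
        change e.comp (Ext.mk₀ (scalarHom A (a • s))) (add_zero n) = _
        rw [scalarHom_smul, Ext.mk₀_smul, Ext.comp_smul]
        rfl }

theorem tensorExt_tmul {M : ModuleCat.{u} A} {n : ℕ} (s : S)
    (e : Ext.{u} M (ModuleCat.of A A) n) :
    tensorExt A S M n (s ⊗ₜ e) = e.comp (Ext.mk₀ (scalarHom A s)) (add_zero n) :=
  rfl

theorem tensorExt_precomp {M M' : ModuleCat.{u} A} {m n n' : ℕ} (α : Ext.{u} M M' m)
    (h : m + n = n') (ζ : S ⊗[A] Ext.{u} M' (ModuleCat.of A A) n) :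
    tensorExt A S M n' ((α.precompOfLinear A (ModuleCat.of A A) h).lTensor S ζ) =
      α.comp (tensorExt A S M' n ζ) h := by
  induction ζ using TensorProduct.induction_on with
  | zero => simp only [map_zero, Ext.comp_zero]
  | tmul s e =>
    rw [LinearMap.lTensor_tmul, tensorExt_tmul, tensorExt_tmul]
    exact Ext.comp_assoc_of_third_deg_zero _ _ _ _
  | add x y hx hy => simp only [map_add, Ext.comp_add, hx, hy]

/-- The coordinate functions on a finite free module, as elements of `Ext^0`. -/
def coordExt {m : ℕ} (i : Fin m) :
    Ext.{u} (ModuleCat.of A (Fin m → A)) (ModuleCat.of A A) 0 :=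
  Ext.mk₀ (ModuleCat.ofHom (LinearMap.proj i))

theorem tensorExt_sum_coordExt {m : ℕ} (s : Fin m → S) :
    tensorExt A S (ModuleCat.of A (Fin m → A)) 0 (∑ i, s i ⊗ₜ coordExt i) =
      Ext.mk₀ (ModuleCat.ofHom (∑ i, (LinearMap.toSpanSingleton A S (s i)).comp
        (LinearMap.proj i))) := by
  rw [map_sum]
  simp only [tensorExt_tmul, coordExt, Ext.mk₀_comp_mk₀]
  have : ∀ f : Fin m → (ModuleCat.of A (Fin m → A) ⟶ ModuleCat.of A S),
      ∑ i, Ext.mk₀.{u} (f i) = Ext.mk₀ (∑ i, f i) := fun f =>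
    (map_sum (Ext.addEquiv₀.{u} (X := ModuleCat.of A (Fin m → A))
      (Y := ModuleCat.of A S)).symm f Finset.univ).symm
  refine (this _).trans (congrArg Ext.mk₀ ?_)
  ext x
  simp [scalarHom, ModuleCat.hom_sum]

theorem exists_eq_sum_coordExt {m : ℕ}
    (ζ : S ⊗[A] Ext.{u} (ModuleCat.of A (Fin m → A)) (ModuleCat.of A A) 0) :
    ∃ s : Fin m → S, ζ = ∑ i, s i ⊗ₜ coordExt i := by
  induction ζ using TensorProduct.induction_on with
  | zero => exact ⟨0, by simp⟩
  | tmul s e =>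
    obtain ⟨f, rfl⟩ := Ext.addEquiv₀.symm.surjective e
    refine ⟨fun i => f.hom (Pi.single i (1 : A)) • s, ?_⟩
    have hf : f = ∑ i, f.hom (Pi.single i (1 : A)) •
        (ModuleCat.ofHom (LinearMap.proj i) : ModuleCat.of A (Fin m → A) ⟶ ModuleCat.of A A) := by
      ext i
      simp [ModuleCat.hom_sum, Pi.single_apply]
    have hsum : Ext.addEquiv₀.symm f = ∑ i, f.hom (Pi.single i (1 : A)) • coordExt i := by
      refine (congrArg Ext.addEquiv₀.symm hf).trans ((map_sum _ _ _).trans ?_)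
      exact Finset.sum_congr rfl fun i _ => Ext.mk₀_smul _ _
    rw [hsum, tmul_sum]
    simp only [tmul_smul, smul_tmul']
  | add x y hx hy =>
    obtain ⟨s, rfl⟩ := hx
    obtain ⟨t, rfl⟩ := hy
    exact ⟨s + t, by simp [add_tmul, Finset.sum_add_distrib]⟩

theorem tensorExt_free_injective (m : ℕ) :
    Function.Injective (tensorExt A S (ModuleCat.of A (Fin m → A)) 0) := by
  rw [← LinearMap.ker_eq_bot, LinearMap.ker_eq_bot']
  intro ζ hζ
  obtain ⟨s, rfl⟩ := exists_eq_sum_coordExt ζ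
  rw [tensorExt_sum_coordExt] at hζ
  have h0 : ModuleCat.ofHom (∑ i, (LinearMap.toSpanSingleton A S (s i)).comp
        (LinearMap.proj i)) = (0 : ModuleCat.of A (Fin m → A) ⟶ ModuleCat.of A S) :=
    Ext.addEquiv₀.symm.injective (hζ.trans (map_zero _).symm)
  refine Finset.sum_eq_zero fun j _ => ?_
  have h1 := congrArg (fun φ => φ.hom (Pi.single j (1 : A))) h0
  have h2 : s j = 0 := by
    simpa [Pi.single_apply, ite_smul] using h1
  rw [h2, zero_tmul]

theorem tensorExt_free_surjective (m n : ℕ) :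
    Function.Surjective (tensorExt A S (ModuleCat.of A (Fin m → A)) n) := by
  intro y
  obtain _ | n := n
  · obtain ⟨f, rfl⟩ := Ext.addEquiv₀.symm.surjective y
    refine ⟨∑ i, f.hom (Pi.single i (1 : A)) ⊗ₜ coordExt i, ?_⟩
    rw [tensorExt_sum_coordExt]
    refine congrArg Ext.mk₀ ?_
    ext i
    simp [Pi.single_apply, ite_smul]
  · have : Projective (ModuleCat.of A (Fin m → A)) := inferInstance
    exact ⟨0, (map_zero _).trans (Ext.eq_zero_of_projective y).symm⟩

end TensorExt

/-! ### Almost injectivity of the Ext comparison for finite modules. -/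

section AlmostInjective

open TensorProduct Abelian

variable {p : ℕ} [Fact p.Prime] {A S : Type u} [CommRing A] [CommRing S] [Algebra (Kcirc p) S]
  [Algebra A S]

theorem smul_lTensor {M N : Type u} [AddCommGroup M] [Module A M] [AddCommGroup N] [Module A N]
    (f : M →ₗ[A] N) (c : S) (z : S ⊗[A] M) : f.lTensor S (c • z) = c • f.lTensor S z :=
  map_smul (f.baseChange S) c z

/-- Dimension shifting along 0 → K → A^m → M → 0, with K finite as A is Noetherian. In degree 0,
Hom(M, A) embeds in Hom(A^m, A), where the comparison is injective. Almost flatness enters only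
there, so one root of `p` serves in all degrees. -/
theorem IsAlmostFlat.smul_eq_zero_of_tensorExt_eq_zero [IsNoetherianRing A]
    (h : IsAlmostFlat p A S) (n : ℕ)
    (M : ModuleCat.{u} A) [Module.Finite A M] (ζ : S ⊗[A] Ext.{u} M (ModuleCat.of A A) n)
    (hζ : tensorExt A S M n ζ = 0) (k : ℕ) (hk : 0 < k) : pRootIn p S k • ζ = 0 := by
  induction n generalizing M with
  | zero =>
    obtain ⟨m, f, hf⟩ := Module.Finite.exists_fin' A M
    let g : ModuleCat.of A (Fin m → A) ⟶ M := ModuleCat.ofHom f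
    have hg : Epi g := (ModuleCat.epi_iff_surjective _).mpr hf
    refine h.smul_eq_zero (j := (Ext.mk₀ g).precompOfLinear A (ModuleCat.of A A) (zero_add 0))
      (Ext.precomp_mk₀_injective_of_epi _ g) ?_ hk
    apply tensorExt_free_injective
    rw [tensorExt_precomp, hζ, Ext.comp_zero, map_zero]
  | succ n ih =>
    obtain ⟨m, f, hf⟩ := Module.Finite.exists_fin' A M
    have hS := LinearMap.shortExact_shortComplexKer hf
    have : Module.Finite A f.shortComplexKer.X₁ :=
      inferInstanceAs (Module.Finite A (LinearMap.ker f))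
    have : Projective f.shortComplexKer.X₂ :=
      inferInstanceAs (Projective (ModuleCat.of A (Fin m → A)))
    have hsurj : Function.Surjective (hS.extClass.precompOfLinear A (ModuleCat.of A A)
        (add_comm 1 n)) := precomp_extClass_surjective_of_projective_X₂ _ hS n
    obtain ⟨ζ', rfl⟩ := LinearMap.lTensor_surjective S hsurj ζ
    have h1 := (tensorExt_precomp _ _ _).symm.trans hζ
    obtain ⟨y, hy⟩ := Ext.contravariant_sequence_exact₁ hS _ _ _ h1
    obtain ⟨y, rfl⟩ := tensorExt_free_surjective m n y
    -- The image of ζ' in Ext^n(K, S) comes from the free module, so subtracting a class `y` from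
    -- there puts ζ' in the kernel for K. The connecting map does not see `y`.
    have h2 : pRootIn p S k • (ζ' - ((Ext.mk₀ f.shortComplexKer.f).precompOfLinear A
        (ModuleCat.of A A) (zero_add n)).lTensor S y) = 0 := by
      refine ih f.shortComplexKer.X₁ _ ?_
      rw [map_sub, sub_eq_zero]
      refine hy.symm.trans (tensorExt_precomp _ _ _).symm
    rw [smul_sub, sub_eq_zero] at h2
    rw [← smul_lTensor, h2, smul_lTensor, ← LinearMap.comp_apply, ← LinearMap.lTensor_comp]
    have h3 : (hS.extClass.precompOfLinear A (ModuleCat.of A A) (add_comm 1 n)).comp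
        ((Ext.mk₀ f.shortComplexKer.f).precompOfLinear A
        (ModuleCat.of A A) (zero_add n)) = 0 := by
      ext e
      exact hS.extClass_comp_assoc _ (h := add_comm 1 n)
    rw [h3, LinearMap.lTensor_zero, LinearMap.zero_apply, smul_zero]

end AlmostInjective
end PerfectoidTest
end

noncomputable section

namespace PerfectoidTest

/-! ### Almost injectivity of S ⊗ H^{i+1}_𝔪(A) → H^{i+1}_𝔪(S). -/

section TensorLocalCohomology

open TensorProduct Abelian IsLocalRing

variable {A S : Type u} [CommRing A] [CommRing S] [Algebra A S] {J : Ideal A}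

variable (S J) in
/-- The map `S ⊗ colim Ext^i(A / J ^ t, A) → colim Ext^i(A / J ^ t, S)`. -/
def tensorLimExt (i : ℕ) :
    S ⊗[A] limExt J i (ModuleCat.of A A) →ₗ[A] limExt J i (ModuleCat.of A S) :=
  TensorProduct.lift
    { toFun s := limExtMap i (scalarHom A s)
      map_add' s t := by
        refine LinearMap.ext fun x => ?_
        obtain ⟨r, e, rfl⟩ := exists_toLimExt x
        rw [LinearMap.add_apply, limExtMap_toLimExt, limExtMap_toLimExt, limExtMap_toLimExt,
          scalarHom_add, Ext.mk₀_add, Ext.comp_add, map_add]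
      map_smul' a s := by
        refine LinearMap.ext fun x => ?_
        obtain ⟨r, e, rfl⟩ := exists_toLimExt x
        rw [RingHom.id_apply, LinearMap.smul_apply, limExtMap_toLimExt, limExtMap_toLimExt,
          scalarHom_smul, Ext.mk₀_smul, Ext.comp_smul, map_smul] }

theorem tensorLimExt_tmul {i : ℕ} (s : S) (x : limExt J i (ModuleCat.of A A)) :
    tensorLimExt S J i (s ⊗ₜ x) = limExtMap i (scalarHom A s) x :=
  rfl

theorem tensorLimExt_lTensor_toLimExt {i t : ℕ}
    (ζ : S ⊗[A] Ext.{u} (powQuot J t) (ModuleCat.of A A) i) :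
    tensorLimExt S J i ((toLimExt J i (ModuleCat.of A A) t).lTensor S ζ) =
      toLimExt J i (ModuleCat.of A S) t (tensorExt A S (powQuot J t) i ζ) := by
  induction ζ using TensorProduct.induction_on with
  | zero => simp only [map_zero]
  | tmul s e =>
    rw [LinearMap.lTensor_tmul, tensorLimExt_tmul, limExtMap_toLimExt, tensorExt_tmul]
  | add x y hx hy => simp only [map_add, hx, hy]

theorem lTensor_toLimExt_transition {i s t : ℕ} (h : s ≤ t)
    (ζ : S ⊗[A] Ext.{u} (powQuot J s) (ModuleCat.of A A) i) :
    (toLimExt J i (ModuleCat.of A A) t).lTensor S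
      (((Ext.mk₀ (powQuotMap J h)).precompOfLinear A (ModuleCat.of A A) (zero_add i)).lTensor S ζ) =
      (toLimExt J i (ModuleCat.of A A) s).lTensor S ζ := by
  rw [← LinearMap.comp_apply, ← LinearMap.lTensor_comp]
  congr 2
  ext e
  exact toLimExt_transition h e

theorem exists_lTensor_toLimExt {i : ℕ} (z : S ⊗[A] limExt J i (ModuleCat.of A A)) :
    ∃ t ζ, (toLimExt J i (ModuleCat.of A A) t).lTensor S ζ = z := by
  induction z using TensorProduct.induction_on with
  | zero => exact ⟨0, 0, map_zero _⟩
  | tmul s x =>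
    obtain ⟨t, e, rfl⟩ := exists_toLimExt x
    exact ⟨t, s ⊗ₜ e, LinearMap.lTensor_tmul _ _ _ _⟩
  | add x y hx hy =>
    obtain ⟨t, x, rfl⟩ := hx
    obtain ⟨t', y, rfl⟩ := hy
    rw [← lTensor_toLimExt_transition (le_max_left t t') x,
      ← lTensor_toLimExt_transition (le_max_right t t') y, ← map_add]
    exact ⟨_, _, rfl⟩

variable {p : ℕ} [Fact p.Prime] [Algebra (Kcirc p) S]

theorem IsAlmostFlat.smul_eq_zero_of_tensorLimExt_eq_zero [IsNoetherianRing A]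
    (h : IsAlmostFlat p A S) {i : ℕ} {z : S ⊗[A] limExt J i (ModuleCat.of A A)}
    (hz : tensorLimExt S J i z = 0) {k : ℕ} (hk : 0 < k) : pRootIn p S k • z = 0 := by
  obtain ⟨s, ζ, rfl⟩ := exists_lTensor_toLimExt z
  rw [tensorLimExt_lTensor_toLimExt] at hz
  obtain ⟨t, hst, ht⟩ := toLimExt_eq_zero hz
  rw [← lTensor_toLimExt_transition hst, ← smul_lTensor]
  have : Module.Finite A (powQuot J t) := inferInstanceAs (Module.Finite A (A ⧸ J ^ t))
  rw [h.smul_eq_zero_of_tensorExt_eq_zero i (powQuot J t) _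
    ((tensorExt_precomp _ _ _).trans ht) k hk, map_zero]

variable [IsLocalRing A]

theorem Hmul_Hmap {d : ℕ} (s : S) (η : H A d A) :
    Hmul A S d s (Hmap A S d η) =
      ((localCohomology (maximalIdeal A) d).map (scalarHom A s)).hom η := by
  have h : ModuleCat.ofHom (Algebra.linearMap A S) ≫ ModuleCat.ofHom (LinearMap.mulLeft A s) =
      scalarHom A s := by
    ext
    change s * algebraMap A S 1 = (1 : A) • s
    rw [map_one, mul_one, one_smul]
  rw [← h, Functor.map_comp]
  rfl

theorem Hmul_mul {d : ℕ} (s t : S) (x : H A d S) :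
    Hmul A S d (s * t) x = Hmul A S d s (Hmul A S d t x) := by
  have h : ModuleCat.ofHom (LinearMap.mulLeft A t) ≫ ModuleCat.ofHom (LinearMap.mulLeft A s) =
      ModuleCat.ofHom (LinearMap.mulLeft A (s * t)) := by
    ext x
    exact (mul_assoc s t x).symm
  rw [Hmul, ← h, Functor.map_comp]
  rfl

variable (A S) in
/-- The map `S ⊗ H^{i+1}(A) → H^{i+1}(S)`. -/
def tensorLocalCohomology (i : ℕ) : S ⊗[A] H A (i + 1) A →ₗ[A] H A (i + 1) S :=
  limExtToLocalCohomology (maximalIdeal A) i (ModuleCat.of A S) ∘ₗ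
    tensorLimExt S (maximalIdeal A) (i + 1) ∘ₗ
      (LinearEquiv.ofBijective _ (limExtToLocalCohomology_bijective (J := maximalIdeal A) i
        (ModuleCat.of A A))).symm.toLinearMap.lTensor S

theorem tensorLocalCohomology_tmul {i : ℕ} (s : S) (η : H A (i + 1) A) :
    tensorLocalCohomology A S i (s ⊗ₜ η) = Hmul A S (i + 1) s (Hmap A S (i + 1) η) := by
  obtain ⟨x, rfl⟩ := (LinearEquiv.ofBijective _ (limExtToLocalCohomology_bijective
    (J := maximalIdeal A) i (ModuleCat.of A A))).surjective η
  rw [Hmul_Hmap]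
  refine Eq.trans ?_ (map_limExtToLocalCohomology (scalarHom A s) x).symm
  change limExtToLocalCohomology (maximalIdeal A) i (ModuleCat.of A S)
    (limExtMap (i + 1) (scalarHom A s) (LinearEquiv.symm _ (_ : H A (i + 1) A))) = _
  rw [LinearEquiv.symm_apply_apply]

theorem IsAlmostFlat.smul_eq_zero_of_tensorLocalCohomology_eq_zero [IsNoetherianRing A]
    (h : IsAlmostFlat p A S) {i : ℕ} {z : S ⊗[A] H A (i + 1) A}
    (hz : tensorLocalCohomology A S i z = 0) {k : ℕ} (hk : 0 < k) : pRootIn p S k • z = 0 := by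
  have h1 := h.smul_eq_zero_of_tensorLimExt_eq_zero
    ((limExtToLocalCohomology_bijective (J := maximalIdeal A) i (ModuleCat.of A S)).injective
      (hz.trans (map_zero _).symm)) hk
  rw [← smul_lTensor] at h1
  let e := LinearEquiv.ofBijective _ (limExtToLocalCohomology_bijective (J := maximalIdeal A) i
    (ModuleCat.of A A))
  exact (LinearEquiv.map_eq_zero_iff (e.symm.lTensor S)).mp h1

end TensorLocalCohomology
end PerfectoidTest
end

noncomputable section

namespace PerfectoidTest

/-! ### The product inequality for annihilators. -/

section ZeroStar

open TensorProduct IsLocalRing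

variable {p : ℕ} [Fact p.Prime]

theorem pRootIn_add_pow {S : Type u} [CommRing S] [Algebra (Kcirc p) S] (k j : ℕ) :
    pRootIn p S (k + j) ^ p ^ j = pRootIn p S k := by
  induction j with
  | zero => rw [pow_zero, pow_one, add_zero]
  | succ j ih =>
    rw [← ih, pow_succ', pow_mul]
    congr 1
    rw [pRootIn, pRootIn, ← map_pow, ← add_assoc, pRoot_succ_pow]

/-- The main argument spends four factors p^{1/p^{k+2}}, and 4 ≤ p². -/
theorem pRootIn_add_two_pow_four_dvd {S : Type u} [CommRing S] [Algebra (Kcirc p) S] (k : ℕ) :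
    pRootIn p S (k + 2) ^ 4 ∣ pRootIn p S k := by
  rw [← pRootIn_add_pow k 2]
  exact pow_dvd_pow _ (Nat.pow_le_pow_left (Fact.out : p.Prime).two_le 2)

variable {A S : Type u} [CommRing A] [CommRing S] [Algebra (Kcirc p) S] [Algebra A S]
  [IsLocalRing A] [IsNoetherianRing A] [IsPrecomplete (maximalIdeal A) A]

/-- Duality turns the claim into: every η killed by the product ideal lies in `zeroStar` of Ξ. -/
theorem IsMatlis.annihilator_zeroStar_le_mul {n : ℕ} {q : ℕ → Ideal A}
    (hH : IsMatlis (H A (n + 1) A) q) (hflat : IsAlmostFlat p A S) {Λ Λ' Ξ : Set S}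
    (hΞ : ∀ x ∈ Ξ, ∃ y ∈ Λ, ∃ z ∈ Λ', x = y * z) :
    (zeroStar p A S (n + 1) Ξ).annihilator ≤
      (zeroStar p A S (n + 1) Λ).annihilator * (zeroStar p A S (n + 1) Λ').annihilator := by
  set I := (zeroStar p A S (n + 1) Λ).annihilator with hI
  set J := (zeroStar p A S (n + 1) Λ').annihilator with hJ
  intro a ha
  refine hH.mem_of_forall_smul_eq_zero fun η hη => ?_
  refine Submodule.mem_annihilator.mp ha η ?_
  intro x hx k hk
  obtain ⟨y, hy, z, hz, rfl⟩ := hΞ x hx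
  have hk2 : 0 < k + 2 := by omega
  set π := pRootIn p S (k + 2) with hπ
  -- One π comes from the definition of `zeroStar` for Λ, the other from almost injectivity into
  -- local cohomology of S.
  have h1 : ∀ b ∈ J, (π * (π * y)) ⊗ₜ[A] (b • η) = 0 := by
    intro b hb
    have h2 : b • η ∈ zeroStar p A S (n + 1) Λ :=
      hH.mem_of_forall_annihilator_smul_eq_zero _ fun a ha => by
        rw [smul_smul]
        exact hη _ (Ideal.mul_mem_mul ha hb)
    have h3 := hflat.smul_eq_zero_of_tensorLocalCohomology_eq_zero (z := (π * y) ⊗ₜ[A] (b • η))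
      ((tensorLocalCohomology_tmul _ _).trans (h2 y hy (k + 2) hk2)) hk2
    rwa [TensorProduct.smul_tmul', smul_eq_mul] at h3
  obtain ⟨s, hs⟩ : J.FG := IsNoetherian.noetherian J
  let β : H A (n + 1) A →ₗ[A] (s → H A (n + 1) A) := LinearMap.pi fun b => LinearMap.lsmul A _ b.1
  -- The kernel is killed by generators of J, so by all of J, and double annihilation applies.
  have hker : LinearMap.ker β ≤ zeroStar p A S (n + 1) Λ' := by
    intro θ hθ
    refine hH.mem_of_forall_annihilator_smul_eq_zero _ fun b hb => ?_
    have h2 : J ≤ LinearMap.ker (LinearMap.toSpanSingleton A _ θ) := by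
      rw [← hs, Submodule.span_le]
      exact fun c hc => congrFun (LinearMap.mem_ker.mp hθ) ⟨c, hc⟩
    exact h2 hb
  have hβ : (π * (π * y)) ⊗ₜ[A] β η = 0 := by
    classical
    rw [← LinearMap.sum_single_apply _ (β η), tmul_sum]
    refine Finset.sum_eq_zero fun b _ => ?_
    have h2 := congrArg ((LinearMap.single A (fun _ : s => H A (n + 1) A) b).lTensor S)
      (h1 b (by rw [← hs]; exact Submodule.subset_span b.2))
    rwa [LinearMap.lTensor_tmul, map_zero] at h2
  -- A third π: H/ker β embeds in a finite power of H, where y ⊗ η was just shown to vanish after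
  -- two.
  have hj := hflat.smul_eq_zero (j := (LinearMap.ker β).liftQ β le_rfl)
    (by rw [← LinearMap.ker_eq_bot, Submodule.ker_liftQ_eq_bot' _ _ rfl])
    (z := (π * (π * y)) ⊗ₜ[A] (LinearMap.ker β).mkQ η)
    (by rw [LinearMap.lTensor_tmul, ← hβ]; rfl) hk2
  rw [TensorProduct.smul_tmul', smul_eq_mul, ← hπ] at hj
  obtain ⟨ω, hω⟩ := (lTensor_exact S (LinearMap.exact_subtype_mkQ (LinearMap.ker β))
    (Submodule.mkQ_surjective _) ((π * (π * (π * y))) ⊗ₜ[A] η)).mp hj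
  -- The fourth π comes from the definition of `zeroStar` for Λ'.
  have h4 : ∀ ω : S ⊗[A] LinearMap.ker β, tensorLocalCohomology A S n
      ((π * z) • (LinearMap.ker β).subtype.lTensor S ω) = 0 := by
    intro ω
    induction ω using TensorProduct.induction_on with
    | zero => simp only [map_zero, smul_zero]
    | tmul c θ =>
      rw [LinearMap.lTensor_tmul, TensorProduct.smul_tmul', tensorLocalCohomology_tmul,
        smul_eq_mul, mul_comm, Hmul_mul]
      exact (congrArg _ (hker θ.2 z hz (k + 2) hk2)).trans (map_zero _)
    | add x y hx hy => rw [map_add, smul_add, map_add, hx, hy, add_zero]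
  have h5 := h4 ω
  rw [hω, TensorProduct.smul_tmul', smul_eq_mul] at h5
  obtain ⟨c, hc⟩ := pRootIn_add_two_pow_four_dvd (p := p) (S := S) k
  rw [show pRootIn p S k * (y * z) = c * (π * z * (π * (π * (π * y)))) by rw [hc]; ring,
    Hmul_mul, ← tensorLocalCohomology_tmul, h5, map_zero]

end ZeroStar
end PerfectoidTest
end

noncomputable section

namespace PerfectoidTest

/-! ### Combinatorics of products of roots. -/

section RootProducts

open IsLocalRing

variable {p : ℕ} {A S : Type u} [CommRing A] [CommRing S] [Algebra A S] {ι κ : Type*}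
  {f : ι → A} {F : ∀ i, RootSystem p (algebraMap A S (f i))}

theorem mem_rootProducts_iff {t : ℝ} {e : ℕ} {x : S} : x ∈ rootProducts F t e ↔
    ∃ m : Multiset ι, t * (p : ℝ) ^ e ≤ m.card ∧ x = (m.map fun i => (F i).root e).prod := by
  constructor
  · rintro ⟨a, ha, j, rfl⟩
    refine ⟨(Finset.univ : Finset (Fin a)).val.map j, by simpa using ha, ?_⟩
    rw [Multiset.map_map]
    rfl
  · rintro ⟨m, hm, rfl⟩
    obtain ⟨l, rfl⟩ := Quot.exists_rep m
    refine ⟨l.length, hm, l.get, ?_⟩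
    change (l.map fun i => (F i).root e).prod = _
    rw [← List.prod_ofFn]
    congr 1
    conv_lhs => rw [← List.ofFn_get l, List.map_ofFn]
    rfl

theorem prod_root_eq (m : Multiset ι) (e j : ℕ) : (m.map fun i => (F i).root e).prod =
    ((p ^ j • m).map fun i => (F i).root (e + j)).prod := by
  rw [Multiset.map_nsmul, Multiset.prod_nsmul, ← Multiset.prod_map_pow]
  congr 2
  ext i
  induction j with
  | zero => rw [pow_zero, pow_one, add_zero]
  | succ j ih => rw [ih, pow_succ', pow_mul, ← add_assoc, (F i).root_succ_pow]

theorem exists_one_le_mul_pow (p : ℕ) [Fact p.Prime] {c : ℝ} (hc : 0 < c) (e : ℕ) :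
    ∃ j, 1 ≤ c * (p : ℝ) ^ (e + j) := by
  have hp : (1 : ℝ) < p := by exact_mod_cast (Fact.out : p.Prime).one_lt
  obtain ⟨j, hj⟩ := pow_unbounded_of_one_lt (1 / c) hp
  refine ⟨j, ?_⟩
  have h1 : (p : ℝ) ^ j ≤ p ^ (e + j) := pow_le_pow_right₀ hp.le (by omega)
  rw [div_lt_iff₀' hc] at hj
  nlinarith

theorem exists_le_multiset_card_eq {m : Multiset ι} {k : ℕ} (h : k ≤ m.card) :
    ∃ m' ≤ m, m'.card = k := by
  obtain ⟨l, rfl⟩ := Quot.exists_rep m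
  exact ⟨(l.take k : List ι), (List.take_sublist k l).subperm,
    List.length_take_of_le h⟩

theorem exists_multiset_sym (n q : ℕ) {m : Multiset ι} (h : q * n ≤ m.card) :
    ∃ L : Multiset (Sym ι n), L.card = q ∧ (L.map fun s : Sym ι n => (s : Multiset ι)).sum ≤ m := by
  classical
  induction q generalizing m with
  | zero => exact ⟨0, rfl, by simp⟩
  | succ q ih =>
    rw [add_mul, one_mul] at h
    obtain ⟨m', hm', hcard⟩ := exists_le_multiset_card_eq (m := m) (k := n) (by omega)
    obtain ⟨L, hL, hLm⟩ := ih (m := m - m') (by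
      rw [Multiset.card_sub hm']
      omega)
    refine ⟨Sym.mk m' hcard ::ₘ L, by rw [Multiset.card_cons, hL], ?_⟩
    rw [Multiset.map_cons, Multiset.sum_cons]
    calc m' + _ ≤ m' + (m - m') := by gcongr
      _ = m := add_tsub_cancel_of_le hm'

theorem prod_monomialRoots {n : ℕ} (L : Multiset (Sym ι n)) (e : ℕ) :
    (L.map fun s => (monomialRoots F n s).root e).prod =
      ((L.map fun s : Sym ι n => (s : Multiset ι)).sum.map fun i => (F i).root e).prod := by
  induction L using Multiset.induction_on with
  | empty => simp
  | cons s L ih =>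
    rw [Multiset.map_cons, Multiset.prod_cons, ih, Multiset.map_cons, Multiset.sum_cons,
      Multiset.map_add, Multiset.prod_add]
    rfl

theorem card_sum_sym {n : ℕ} (L : Multiset (Sym ι n)) :
    (L.map fun s : Sym ι n => (s : Multiset ι)).sum.card = L.card * n := by
  induction L using Multiset.induction_on with
  | empty => simp
  | cons s L ih =>
    rw [Multiset.map_cons, Multiset.sum_cons, Multiset.card_add, ih, Multiset.card_cons,
      Sym.card_coe]
    ring

theorem rootProducts_monomialRoots_subset {n : ℕ} {t : ℝ} {e : ℕ} :
    rootProducts (monomialRoots F n) t e ⊆ rootProducts F (t * n) e := by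
  intro x hx
  obtain ⟨L, hL, rfl⟩ := mem_rootProducts_iff.mp hx
  refine mem_rootProducts_iff.mpr ⟨_, ?_, prod_monomialRoots L e⟩
  rw [card_sum_sym]
  push_cast
  rw [mul_right_comm]
  gcongr

variable [Fact p.Prime]

/-- Refine the roots until (ε/2)p^{e+j} ≥ 1, then split off the least number of factors that
suffices for t + ε/4. Rounding up costs at most ε/2, leaving s + ε/4 for the rest. -/
theorem exists_mul_dvd_of_mem_rootProducts {t s ε : ℝ} (hε : 0 < ε) {e : ℕ} {x : S}
    (ht : 0 ≤ t) (hs : 0 ≤ s)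
    (hx : x ∈ rootProducts F (t + s + ε) e) : ∃ j, ∃ y ∈ rootProducts F (t + ε / 4) (e + j),
      ∃ z ∈ rootProducts F (s + ε / 4) (e + j), y * z ∣ x := by
  classical
  obtain ⟨m, hm, rfl⟩ := mem_rootProducts_iff.mp hx
  obtain ⟨j, hj⟩ := exists_one_le_mul_pow p (half_pos hε) e
  have hp : (0 : ℝ) < (p : ℝ) ^ (e + j) := by
    have : (0 : ℝ) < p := by exact_mod_cast (Fact.out : p.Prime).pos
    positivity
  have hcard : (t + s + ε) * (p : ℝ) ^ (e + j) ≤ ((p ^ j • m).card : ℝ) := by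
    rw [Multiset.card_nsmul, pow_add, ← mul_assoc]
    push_cast
    rw [mul_comm ((p : ℝ) ^ j)]
    gcongr
  have hceil := (Nat.ceil_lt_add_one (a := (t + ε / 4) * (p : ℝ) ^ (e + j)) (by positivity)).le
  obtain ⟨m', hm', hm'card⟩ := exists_le_multiset_card_eq (m := p ^ j • m)
    (k := ⌈(t + ε / 4) * (p : ℝ) ^ (e + j)⌉₊) (by
      have : (⌈(t + ε / 4) * (p : ℝ) ^ (e + j)⌉₊ : ℝ) ≤ ((p ^ j • m).card : ℝ) := by
        have : 0 ≤ s * (p : ℝ) ^ (e + j) := by positivity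
        nlinarith
      exact_mod_cast this)
  refine ⟨j, _, mem_rootProducts_iff.mpr ⟨m', ?_, rfl⟩, _,
    mem_rootProducts_iff.mpr ⟨p ^ j • m - m', ?_, rfl⟩, ?_⟩
  · rw [hm'card]
    exact Nat.le_ceil _
  · rw [Multiset.card_sub hm', Nat.cast_sub (Multiset.card_le_card hm'), hm'card]
    nlinarith
  · rw [← Multiset.prod_add, ← Multiset.map_add, add_tsub_cancel_of_le hm', prod_root_eq m e j]

/-- After refining, group the factors `n` at a time and drop the fewer than `n` left over. Of the
surplus ε/n one half absorbs this loss, the other half remains. -/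
theorem exists_dvd_of_mem_rootProducts_mul {n : ℕ} (hn : 0 < n) {t ε : ℝ} (hε : 0 < ε) {e : ℕ}
    {x : S} (hx : x ∈ rootProducts F (t * n + ε) e) :
    ∃ j, ∃ y ∈ rootProducts (monomialRoots F n) (t + ε / (2 * n)) (e + j), y ∣ x := by
  obtain ⟨m, hm, rfl⟩ := mem_rootProducts_iff.mp hx
  have hn' : (0 : ℝ) < n := by exact_mod_cast hn
  obtain ⟨j, hj⟩ := exists_one_le_mul_pow p (c := ε / (2 * n)) (by positivity) e
  have hcard : (t * n + ε) * (p : ℝ) ^ (e + j) ≤ ((p ^ j • m).card : ℝ) := by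
    rw [Multiset.card_nsmul, pow_add, ← mul_assoc]
    push_cast
    rw [mul_comm ((p : ℝ) ^ j)]
    gcongr
  obtain ⟨L, hL, hLm⟩ := exists_multiset_sym n ((p ^ j • m).card / n) (m := p ^ j • m)
    (Nat.div_mul_le_self _ _)
  refine ⟨j, _, mem_rootProducts_iff.mpr ⟨L, ?_, rfl⟩, ?_⟩
  · rw [hL]
    have h1 : ((p ^ j • m).card : ℝ) < ((((p ^ j • m).card / n : ℕ) : ℝ) + 1) * n := by
      have := Nat.lt_div_mul_add (a := (p ^ j • m).card) hn
      have h2 : (p ^ j • m).card < ((p ^ j • m).card / n + 1) * n := by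
        rw [add_mul, one_mul]
        exact this
      exact_mod_cast h2
    have h2 := hcard.trans_lt h1
    rw [← div_lt_iff₀ hn'] at h2
    have h3 : (t * n + ε) * (p : ℝ) ^ (e + j) / n =
        (t + ε / (2 * n)) * (p : ℝ) ^ (e + j) + ε / (2 * n) * (p : ℝ) ^ (e + j) := by
      field_simp
      ring
    rw [h3] at h2
    linarith
  · rw [prod_monomialRoots, prod_root_eq m e j]
    exact Multiset.prod_dvd_prod_of_le (Multiset.map_le_map hLm)

variable [Algebra (Kcirc p) S] [IsLocalRing A]

/-- A class almost killed by y is almost killed by its multiples, so comparing test ideals reduces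
to divisibility of root products. -/
theorem annihilator_zeroStar_le_of_dvd {d : ℕ} {Λ Λ' : Set S}
    (h : ∀ x ∈ Λ', ∃ y ∈ Λ, y ∣ x) :
    (zeroStar p A S d Λ').annihilator ≤ (zeroStar p A S d Λ).annihilator := by
  refine Submodule.annihilator_mono fun η hη x hx k hk => ?_
  obtain ⟨y, hy, c, rfl⟩ := h x hx
  rw [show pRootIn p S k * (y * c) = c * (pRootIn p S k * y) by ring, Hmul_mul, hη y hy k hk,
    map_zero]

theorem tau_add_le_tauMixed {d : ℕ} {t s : ℝ} (ht : 0 ≤ t) (hs : 0 ≤ s) :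
    tau d F (t + s) ≤ tauMixed d F F t s := by
  refine iSup₂_le fun ε hε => le_iSup₂_of_le (ε / 4) (by positivity) ?_
  refine annihilator_zeroStar_le_of_dvd ?_
  rintro x ⟨e, he, hx⟩
  obtain ⟨j, y, hy, z, hz, h⟩ := exists_mul_dvd_of_mem_rootProducts hε ht hs hx
  exact ⟨_, ⟨e + j, by omega, y, hy, z, hz, rfl⟩, h⟩

theorem tau_monomialRoots {d n : ℕ} (hn : 0 < n) {t : ℝ} :
    tau d (monomialRoots F n) t = tau d F (t * n) := by
  have hn' : (0 : ℝ) < n := by exact_mod_cast hn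
  apply le_antisymm
  · refine iSup₂_le fun ε hε => le_iSup₂_of_le (ε * n) (by positivity) ?_
    refine annihilator_zeroStar_le_of_dvd ?_
    rintro x ⟨e, he, hx⟩
    refine ⟨x, ⟨e, he, ?_⟩, dvd_rfl⟩
    rw [← add_mul]
    exact rootProducts_monomialRoots_subset hx
  · refine iSup₂_le fun ε hε => le_iSup₂_of_le (ε / (2 * n)) (by positivity) ?_
    refine annihilator_zeroStar_le_of_dvd ?_
    rintro x ⟨e, he, hx⟩
    obtain ⟨j, y, hy, h⟩ := exists_dvd_of_mem_rootProducts_mul hn hε hx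
    exact ⟨y, ⟨e + j, by omega, hy⟩, h⟩

end RootProducts

/-! ### Assembly of the theorem. -/

section Main

open IsLocalRing

variable {p : ℕ} [Fact p.Prime] {A : Type u} [CommRing A] [IsRegularLocalRing A]

/-- In dimension 0 regularity forces 𝔪 = 0, but 𝔪 contains p ≠ 0. Positivity of `d` is what the
comparison of Ext modules requires. -/
theorem exists_eq_succ_of_ringKrullDim_eq [CharZero A] [CharP (ResidueField A) p] {d : ℕ}
    (hd : ringKrullDim A = d) : ∃ n, d = n + 1 := by
  have := isDomain_of_isRegularLocalRing (R := A)
  refine Nat.exists_eq_succ_of_ne_zero ?_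
  rintro rfl
  have h1 : maximalIdeal A = ⊥ := by
    rw [← Submodule.spanFinrank_eq_zero_iff_eq_bot (IsNoetherian.noetherian _)]
    rw [← IsRegularLocalRing.spanFinrank_maximalIdeal] at hd
    exact_mod_cast hd
  have h2 : (p : A) ∈ maximalIdeal A := by
    rw [← residue_eq_zero_iff, map_natCast, CharP.cast_eq_zero]
  rw [h1, Ideal.mem_bot] at h2
  exact (Fact.out : p.Prime).ne_zero (by exact_mod_cast h2)

variable [IsAdicComplete (maximalIdeal A) A] {S : Type u} [CommRing S] [Algebra (Kcirc p) S]
  [Algebra A S] {ι κ : Type*} {f : ι → A} {g : κ → A}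

theorem tauSharpMixed_le_mul {n : ℕ} (hd : ringKrullDim A = (n + 1 : ℕ))
    (hS : IsAlmostFlat p A S) (F : ∀ i, RootSystem p (algebraMap A S (f i)))
    (G : ∀ i, RootSystem p (algebraMap A S (g i))) (t s : ℝ) :
    tauSharpMixed (n + 1) F G t s ≤ tauSharp (n + 1) F t * tauSharp (n + 1) G s := by
  obtain ⟨q, hq⟩ := exists_isMatlis_localCohomology hd
  refine hq.annihilator_zeroStar_le_mul hS ?_
  rintro x ⟨e, he, y, hy, z, hz, rfl⟩
  exact ⟨y, ⟨e, he, hy⟩, z, ⟨e, he, hz⟩, rfl⟩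

theorem tauMixed_le_mul {n : ℕ} (hd : ringKrullDim A = (n + 1 : ℕ))
    (hS : IsAlmostFlat p A S) (F : ∀ i, RootSystem p (algebraMap A S (f i)))
    (G : ∀ i, RootSystem p (algebraMap A S (g i))) (t s : ℝ) :
    tauMixed (n + 1) F G t s ≤ tau (n + 1) F t * tau (n + 1) G s :=
  iSup₂_le fun ε hε => (tauSharpMixed_le_mul hd hS F G _ _).trans
    (Ideal.mul_mono (le_iSup₂_of_le ε hε le_rfl) (le_iSup₂_of_le ε hε le_rfl))

theorem tau_mul_le_pow {n : ℕ} (hd : ringKrullDim A = (n + 1 : ℕ))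
    (hS : IsAlmostFlat p A S) (F : ∀ i, RootSystem p (algebraMap A S (f i))) {t : ℝ}
    (ht : 0 ≤ t) (N : ℕ) : tau (n + 1) F (t * N) ≤ tau (n + 1) F t ^ N := by
  induction N with
  | zero => rw [pow_zero, Ideal.one_eq_top]; exact le_top
  | succ N ih =>
    rw [Nat.cast_succ, mul_add, mul_one, pow_succ]
    exact (tau_add_le_tauMixed (by positivity) ht).trans
      ((tauMixed_le_mul hd hS F F _ _).trans (Ideal.mul_mono_left ih))

end Main
end PerfectoidTest
end

open PerfectoidTest in
theorem mainTheorem7 {p : ℕ} [Fact p.Prime] {A : Type u} [CommRing A] [IsRegularLocalRing A]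
    [IsAdicComplete (IsLocalRing.maximalIdeal A) A] [CharZero A]
    [CharP (IsLocalRing.ResidueField A) p] {d : ℕ} (hd : ringKrullDim A = d)
    {S : Type u} [CommRing S] [Algebra (Kcirc p) S] [Algebra A S] (hS : IsAinfty p A S)
    {ι κ : Type*} [Finite ι] [Finite κ] {f : ι → A} {g : κ → A}
    (F : ∀ i, RootSystem p (algebraMap A S (f i)))
    (G : ∀ i, RootSystem p (algebraMap A S (g i))) :
    (∀ t s : ℝ, 0 ≤ t → 0 ≤ s →
      tauSharpMixed d F G t s ≤ tauSharp d F t * tauSharp d G s ∧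
      tauMixed d F G t s ≤ tau d F t * tau d G s) ∧
    (∀ t : ℝ, 0 ≤ t → ∀ n : ℕ,
      (0 < n → tau d (monomialRoots F n) t = tau d F (t * n)) ∧
      tau d F (t * n) ≤ tau d F t ^ n) := by
  obtain ⟨m, rfl⟩ := exists_eq_succ_of_ringKrullDim_eq (p := p) hd
  exact ⟨fun t s _ _ => ⟨tauSharpMixed_le_mul hd hS.almostFlat F G t s,
    tauMixed_le_mul hd hS.almostFlat F G t s⟩,
    fun t ht n => ⟨fun hn => tau_monomialRoots hn, tau_mul_le_pow hd hS.almostFlat F ht n⟩⟩
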